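/- For $g\in L^2(\mathbb R)$ with compact support let $Eg(x,t)=\int_{\mathbb R} e^{i(\omega^2t+\omega x)}g(\omega)\,d\omega$, and let $B_R\subset\mathbb R^2$ be the disc of radius $R$ centred at the origin. Let $R>0$ and let $f:[-1,1]\to\mathbb C$ be smooth, extended by $0$ to $\mathbb R$. Given constants $A\ge1$ and $(K_N)_{N\ge1}$, a *wave packet decomposition of $f$ of size $R$ (with constants $A,K_N$)* is an expansion, unconditionally convergent in $L^2(\mathbb R)$, $$f=\sum_{\theta,v}f_{\theta,v}=\sum_{\theta,v}c_{\theta,v}\phi_{\theta,v},\qquad \theta\in R^{-1/2}\mathbb Z\cap[-1,1],\quad v\in R^{1/2}\mathbb Z,$$ with $c_{\theta,v}\in\mathbb C$ and $\phi_{\theta,v}\in L^2(\mathbb R)$ supported in $[\theta-3R^{-1/2},\theta+3R^{-1/2}]$, such that $$A^{-1}\|f\|_{L^2}^2\le\sum_{\theta,v}|c_{\theta,v}|^2\le A\|f\|_{L^2}^2,\qquad |c_{\theta_0,v_0}|\le A\max_{\theta,v}\|f_{\theta,v}\|_{L^2}\ \text{ for all }\theta_0,v_0,$$ $$|E\phi_{\theta,v}(x,t)|\le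 K_N R^{-1/4}\bigl(1+|x-v+2\theta t|R^{-1/2}\bigr)^{-N}\qquad\text{for all } x\in\mathbb R,\ |t|\le R,\ N\ge1.$$ Put $S=\max_{\theta,v}\|f_{\theta,v}\|_{L^2}/\|f\|_{L^2}$. **Proposition.** For every $\epsilon>0$ and all constants $A,(K_N)$ there is a constant $C=C(\epsilon,A,(K_N))$, independent of $R$, of $f$ and of the decomposition, such that $$\|Ef\|_{L^4(B_R)}\le C\,R^{\frac18+\epsilon}\,S^{\frac14-\epsilon}\,\|f\|_{L^2}$$ for every $R>0$ (with $R\ge1$ if $\epsilon>\frac18$), every smooth $f:[-1,1]\to\mathbb C$, and every wave packet decomposition of $f$ of size $R$ with constants $A,K_N$ (for $f=0$ the inequality reads $0\le0$). -/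

import Mathlib

open MeasureTheory Set Filter
open scoped NNReal ENNReal Topology

noncomputable section

namespace WavePacket

/-- The extension operator `Ef(x,t) = ∫ e^{i(ω² t + ω x)} f(ω) dω`. It is applied both to functions
that vanish outside `[-1,1]` (where it is the integral over `[-1,1]`) and to wave packets,
whose supports may stick out of `[-1,1]` by `O(R^{-1/2})`. -/
def extensionOp (f : ℝ → ℂ) (x t : ℝ) : ℂ :=
  ∫ ω : ℝ, Complex.exp (Complex.I * ((ω ^ 2 * t + ω * x : ℝ) : ℂ)) * f ω

/-- The Euclidean disc `B_R` of points `(x,t)`, centred at the origin. -/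
def disc (R : ℝ) : Set (ℝ × ℝ) := {z | z.1 ^ 2 + z.2 ^ 2 ≤ R ^ 2}

/-- Indices `(k, m)` of the wave packets of size `R`: the frequency is `θ = k R^{-1/2} ∈ [-1,1]`
and the position is `v = m R^{1/2}`. -/
abbrev Index (R : ℝ) : Type := {k : ℤ // (k : ℝ) * R ^ (-(1 / 2) : ℝ) ∈ Icc (-1 : ℝ) 1} × ℤ

/-- The frequency `θ ∈ R^{-1/2}ℤ ∩ [-1,1]` of an index. -/
def freq {R : ℝ} (q : Index R) : ℝ := ((q.1 : ℤ) : ℝ) * R ^ (-(1 / 2) : ℝ)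

/-- The position `v ∈ R^{1/2}ℤ` of an index. -/
def pos {R : ℝ} (q : Index R) : ℝ := (q.2 : ℝ) * R ^ (1 / 2 : ℝ)

/-- The wave packet `f_{θ,v} = c_{θ,v} φ_{θ,v}`. -/
def packet {R : ℝ} (c : Index R → ℂ) (φ : Index R → ℝ → ℂ) (q : Index R) : ℝ → ℂ :=
  fun ω => c q * φ q ω

/-- The size `M = max_{θ,v} ‖f_{θ,v}‖_{L²}` of the largest wave packet. -/
def maxPacket {R : ℝ} (c : Index R → ℂ) (φ : Index R → ℝ → ℂ) : ℝ≥0∞ :=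
  ⨆ q : Index R, eLpNorm (packet c φ q) 2 volume

/-- The ratio `S = max_{θ,v} ‖f_{θ,v}‖_{L²} / ‖f‖_{L²}`. -/
def sizeRatio {R : ℝ} (f : ℝ → ℂ) (c : Index R → ℂ) (φ : Index R → ℝ → ℂ) : ℝ≥0∞ :=
  maxPacket c φ / eLpNorm f 2 volume

/-- `f = ∑ c_{θ,v} φ_{θ,v}` is a wave packet decomposition of size `R`, where `A` and `K N` are
the implied constants. For the phase `ω² t + ω x` the packet `(θ,v)` travels along the line
`x = v - 2 θ t`, and it stays within a tube of width `R^{1/2}` for times `|t| ≤ R`. -/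
structure IsDecomposition (R : ℝ) (A : ℝ≥0) (K : ℕ → ℝ) (f : ℝ → ℂ)
    (c : Index R → ℂ) (φ : Index R → ℝ → ℂ) : Prop where
  memLp : ∀ q, MemLp (φ q) 2 volume
  /-- The sum of the wave packets is `f`, unconditionally in `L²`. -/
  sum_eq : Tendsto
    (fun s : Finset (Index R) => eLpNorm (fun ω => f ω - ∑ q ∈ s, packet c φ q ω) 2 volume)
    atTop (𝓝 0)
  support_subset : ∀ q, Function.support (φ q) ⊆
    Icc (freq q - 3 * R ^ (-(1 / 2) : ℝ)) (freq q + 3 * R ^ (-(1 / 2) : ℝ))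
  sum_sq_le : ∑' q, ‖c q‖ₑ ^ 2 ≤ A * eLpNorm f 2 volume ^ 2
  le_sum_sq : eLpNorm f 2 volume ^ 2 ≤ A * ∑' q, ‖c q‖ₑ ^ 2
  coeff_le : ∀ q, ‖c q‖ₑ ≤ A * maxPacket c φ
  decay : ∀ q, ∀ N : ℕ, 0 < N → ∀ x t : ℝ, |t| ≤ R →
    ‖extensionOp (φ q) x t‖ ≤ K N * R ^ (-(1 / 4) : ℝ) /
      (1 + |x - pos q + 2 * freq q * t| * R ^ (-(1 / 2) : ℝ)) ^ N

end WavePacket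

end

/-!
By Fatou's lemma it suffices to bound `E` of a finite sum of packets, given a bound `b` for the
coefficients and a bound `H` for their `ℓ²` norm. A Whitney decomposition of the frequency square
writes `(Ef)²` as a sum over pairs of adjacent frequency cells at the finest scale, plus, for each
of the `O(log R)` dyadic scales `n`, a sum over pairs of cells of length `n R^{-1/2}` whose distance
is comparable to their length. At a fixed scale the products of the pairs are almost orthogonal. For
a separated pair Plancherel's theorem gives the bilinear estimate
`‖Eg Eh‖₂² ≲ ‖g‖₂² ‖h‖₂² R^{1/2} / n`. It is applied on each tube of width `n R^{1/2}` in the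
direction of the cells to the packets that stay within about `ρ` times this width of it, where
`ρ = R^δ`; the decay of the packets makes the contribution of the others negligible. Since there are
`O(ρ n²)` such packets, their `ℓ²` norm is at most both `H` and `b (ρ n²)^{1/2}`, and the powers of
`n` cancel. This gives `‖Ef‖₄⁴ ≲ R^{1/2 + 4ε} b H³`, that is, the factor `S^{1/4}`; as `S` is
bounded, `S^{1/4}` may be traded for `S^{1/4 - ε}`.
-/

noncomputable section

namespace WavePacket

open scoped FourierTransform Convolution SchwartzMap

section Plancherel

variable {V F : Type*} [NormedAddCommGroup V] [InnerProductSpace ℝ V] [FiniteDimensional ℝ V]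
  [MeasurableSpace V] [BorelSpace V] [NormedAddCommGroup F] [InnerProductSpace ℂ F]

theorem continuous_fourier {g : V → F} (hg : Integrable g) : Continuous (𝓕 g) :=
  VectorFourier.fourierIntegral_continuous Real.continuous_fourierChar
    (L := innerₗ V) continuous_inner hg

variable [CompleteSpace F]

/-- Both sides define the same tempered distribution. -/
theorem fourier_ae_eq_fourier_toLp {g : V → F} (hg : Integrable g) (hg2 : MemLp g 2) :
    𝓕 g =ᵐ[volume] (𝓕 (hg2.toLp g) : Lp F 2 (volume : Measure V)) := by
  refine ae_eq_of_integral_contDiff_smul_eq (continuous_fourier hg).locallyIntegrable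
    ((Lp.memLp _).locallyIntegrable (by norm_num)) fun ψ hψ hψc => ?_
  have hΨc : HasCompactSupport (Complex.ofRealCLM ∘ ψ) := hψc.comp_left rfl
  have hΨs : ContDiff ℝ ((⊤ : ℕ∞) : WithTop ℕ∞) (Complex.ofRealCLM ∘ ψ) := by fun_prop
  set Ψ : 𝓢(V, ℂ) := hΨc.toSchwartzMap hΨs
  have hΨ (x : V) : Ψ x = (ψ x : ℂ) := by simp [Ψ]
  have hLp : ∫ x, Ψ x • (𝓕 (hg2.toLp g) : Lp F 2 (volume : Measure V)) x =
      ∫ x, (𝓕 Ψ) x • g x := by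
    have := congrArg (fun T => T Ψ) (Lp.fourier_toTemperedDistribution_eq (hg2.toLp g))
    simp only [TemperedDistribution.fourier_apply, Lp.toTemperedDistribution_apply] at this
    rw [← this]
    refine integral_congr_ae ?_
    filter_upwards [hg2.coeFn_toLp] with x hx
    rw [hx]
  have hL1 : ∫ x, (𝓕 Ψ) x • g x = ∫ x, Ψ x • 𝓕 g x := by
    have := VectorFourier.integral_fourierIntegral_smul_eq_flip (L := innerₗ V)
      Real.continuous_fourierChar continuous_inner (Ψ.integrable (μ := volume)) hg
    rw [SchwartzMap.fourier_coe]
    simpa using! this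
  calc ∫ x, ψ x • 𝓕 g x = ∫ x, Ψ x • 𝓕 g x := by simp [hΨ]
    _ = _ := by rw [← hL1, ← hLp]; simp [hΨ]

theorem eLpNorm_fourier {g : V → F} (hg : Integrable g) (hg2 : MemLp g 2) :
    eLpNorm (𝓕 g) 2 = eLpNorm g 2 := by
  rw [eLpNorm_congr_ae (fourier_ae_eq_fourier_toLp hg hg2)]
  have h := Lp.norm_fourier_eq (hg2.toLp g)
  rw [Lp.norm_def, Lp.norm_def, ENNReal.toReal_eq_toReal_iff' (Lp.eLpNorm_ne_top _)
    (Lp.eLpNorm_ne_top _)] at h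
  rw [h, eLpNorm_congr_ae hg2.coeFn_toLp]

end Plancherel

section LTwo

variable {α E : Type*} [MeasurableSpace α] [NormedAddCommGroup E] {μ : Measure α}

theorem eLpNorm_two_sq (μ : Measure α) (g : α → E) :
    eLpNorm g 2 μ ^ 2 = ∫⁻ x, ‖g x‖ₑ ^ 2 ∂μ := by
  simpa using eLpNorm_nnreal_pow_eq_lintegral (f := g) (μ := μ) (p := 2) two_ne_zero

theorem memLp_two_iff_lintegral_lt_top {g : α → E} (hg : AEStronglyMeasurable g μ) :
    MemLp g 2 μ ↔ ∫⁻ x, ‖g x‖ₑ ^ 2 ∂μ < ∞ := by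
  rw [← eLpNorm_two_sq, ENNReal.pow_lt_top_iff]
  simp [MemLp, hg]

theorem lintegral_enorm_mul_le {f g : α → ℂ} (hf : AEStronglyMeasurable f μ)
    (hg : AEStronglyMeasurable g μ) :
    ∫⁻ x, ‖f x * g x‖ₑ ∂μ ≤ eLpNorm f 2 μ * eLpNorm g 2 μ := by
  simpa [eLpNorm_one_eq_lintegral_enorm] using
    eLpNorm_le_eLpNorm_mul_eLpNorm_of_nnnorm (p := 2) (q := 2) (r := 1) hf hg (· * ·) 1
      (Eventually.of_forall fun x => by simp)

theorem lintegral_enorm_le_of_ae_eq_zero_compl {g : α → E} (hg : AEStronglyMeasurable g μ)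
    {S : Set α} (hS : MeasurableSet S) (hgS : g =ᵐ[μ.restrict Sᶜ] 0) :
    ∫⁻ x, ‖g x‖ₑ ∂μ ≤ μ S ^ (1 / 2 : ℝ) * eLpNorm g 2 μ := by
  have hcompl : ∫⁻ x in Sᶜ, ‖g x‖ₑ ∂μ = 0 := by
    rw [lintegral_congr_ae (hgS.mono fun x hx => congrArg enorm hx)]
    simp
  calc ∫⁻ x, ‖g x‖ₑ ∂μ = eLpNorm g 1 (μ.restrict S) := by
        rw [← lintegral_add_compl _ hS, hcompl, add_zero, eLpNorm_one_eq_lintegral_enorm]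
    _ ≤ eLpNorm g 2 (μ.restrict S) * μ S ^ (1 / 2 : ℝ) := by
        convert eLpNorm_le_eLpNorm_mul_rpow_measure_univ (q := 2) one_le_two hg.restrict using 2
        rw [Measure.restrict_apply_univ]
        norm_num
    _ ≤ _ := by
        rw [mul_comm]
        gcongr
        exact Measure.restrict_le_self

theorem integrable_of_ae_eq_zero_compl {g : α → E} (hg : MemLp g 2 μ) {S : Set α}
    (hS : MeasurableSet S) (hμS : μ S ≠ ∞) (hgS : g =ᵐ[μ.restrict Sᶜ] 0) : Integrable g μ :=
  ⟨hg.1, (lintegral_enorm_le_of_ae_eq_zero_compl hg.1 hS hgS).trans_lt <|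
    ENNReal.mul_lt_top (ENNReal.rpow_lt_top_of_nonneg (by norm_num) hμS) hg.2⟩

theorem ae_eq_zero_compl_of_tendsto_eLpNorm_sub {ι : Type*} {l : Filter ι} [l.NeBot] {f : α → E}
    {g : ι → α → E} {p : ℝ≥0∞} (hp : p ≠ 0) (hf : AEStronglyMeasurable f μ) {S : Set α}
    (hS : MeasurableSet S) (hg : ∀ i, Function.support (g i) ⊆ S)
    (hlim : Tendsto (fun i => eLpNorm (fun x => f x - g i x) p μ) l (𝓝 0)) :
    f =ᵐ[μ.restrict Sᶜ] 0 := by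
  rw [← eLpNorm_eq_zero_iff hf.restrict hp, ← nonpos_iff_eq_zero]
  refine ge_of_tendsto' hlim fun i => ?_
  calc eLpNorm f p (μ.restrict Sᶜ) = eLpNorm (fun x => f x - g i x) p (μ.restrict Sᶜ) := by
        refine eLpNorm_congr_ae (ae_restrict_of_forall_mem hS.compl fun x hx => ?_)
        simp [Function.notMem_support.1 fun h => hx (hg i h)]
    _ ≤ _ := eLpNorm_mono_measure _ Measure.restrict_le_self

end LTwo

section Extension

/-- Multiplication by the quadratic phase `e^{iω²t}`, which turns `E` at time `t` into a
Fourier transform. -/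
def modulate (t : ℝ) (g : ℝ → ℂ) (ω : ℝ) : ℂ :=
  Complex.exp (Complex.I * ((ω ^ 2 * t : ℝ) : ℂ)) * g ω

theorem modulate_zero (g : ℝ → ℂ) : modulate 0 g = g := by
  ext ω
  simp [modulate]

theorem enorm_modulate (t : ℝ) (g : ℝ → ℂ) (ω : ℝ) : ‖modulate t g ω‖ₑ = ‖g ω‖ₑ := by
  rw [modulate, enorm_mul, Complex.enorm_exp_I_mul_ofReal, one_mul]

theorem aestronglyMeasurable_modulate (t : ℝ) {g : ℝ → ℂ} (hg : AEStronglyMeasurable g) :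
    AEStronglyMeasurable (modulate t g) := by
  have : Continuous fun ω : ℝ => Complex.exp (Complex.I * ((ω ^ 2 * t : ℝ) : ℂ)) := by fun_prop
  exact this.aestronglyMeasurable.mul hg

theorem memLp_modulate (t : ℝ) {g : ℝ → ℂ} {p : ℝ≥0∞} (hg : MemLp g p) :
    MemLp (modulate t g) p :=
  hg.congr_enorm (aestronglyMeasurable_modulate t hg.1)
    (Eventually.of_forall fun ω => (enorm_modulate t g ω).symm)

theorem integrable_modulate (t : ℝ) {g : ℝ → ℂ} (hg : Integrable g) : Integrable (modulate t g) :=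
  memLp_one_iff_integrable.1 (memLp_modulate t (memLp_one_iff_integrable.2 hg))

theorem extensionOp_eq_fourier (g : ℝ → ℂ) (x t : ℝ) :
    extensionOp g x t = 𝓕 (modulate t g) (-(2 * Real.pi)⁻¹ * x) := by
  rw [extensionOp, Real.fourier_real_eq_integral_exp_smul]
  refine integral_congr_ae (Eventually.of_forall fun ω => ?_)
  simp only [modulate, smul_eq_mul]
  rw [← mul_assoc, ← Complex.exp_add]
  congr 2
  have : (Real.pi : ℂ) ≠ 0 := by exact_mod_cast Real.pi_ne_zero
  push_cast
  field_simp
  ring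

theorem lintegral_fourier_rescaled_sq {g : ℝ → ℂ} (hg : Integrable g) (hg2 : MemLp g 2) :
    ∫⁻ x, ‖𝓕 g (-(2 * Real.pi)⁻¹ * x)‖ₑ ^ 2 =
      ENNReal.ofReal (2 * Real.pi) * ∫⁻ ω, ‖g ω‖ₑ ^ 2 := by
  have hpi : -(2 * Real.pi)⁻¹ ≠ 0 := neg_ne_zero.2 (inv_ne_zero Real.two_pi_pos.ne')
  have hmap : Measure.map (fun x : ℝ => -(2 * Real.pi)⁻¹ * x) volume =
      ENNReal.ofReal (2 * Real.pi) • volume := by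
    rw [Real.map_volume_mul_left hpi, inv_neg, inv_inv, abs_neg, abs_of_pos Real.two_pi_pos]
  have hcont := continuous_fourier hg
  rw [← lintegral_map (f := fun y => ‖𝓕 g y‖ₑ ^ 2) (g := fun x : ℝ => -(2 * Real.pi)⁻¹ * x)
    (by fun_prop) (by fun_prop), hmap, lintegral_smul_measure, ← eLpNorm_two_sq,
    eLpNorm_fourier hg hg2, eLpNorm_two_sq, smul_eq_mul]

theorem lintegral_extensionOp_sq {g : ℝ → ℂ} (hg : Integrable g) (hg2 : MemLp g 2) (t : ℝ) :
    ∫⁻ x, ‖extensionOp g x t‖ₑ ^ 2 = ENNReal.ofReal (2 * Real.pi) * ∫⁻ ω, ‖g ω‖ₑ ^ 2 := by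
  simp_rw [extensionOp_eq_fourier, lintegral_fourier_rescaled_sq (integrable_modulate t hg)
    (memLp_modulate t hg2), enorm_modulate]

theorem enorm_extensionOp_le (g : ℝ → ℂ) (x t : ℝ) : ‖extensionOp g x t‖ₑ ≤ ∫⁻ ω, ‖g ω‖ₑ := by
  refine (enorm_integral_le_lintegral_enorm _).trans (le_of_eq (lintegral_congr fun ω => ?_))
  rw [enorm_mul, Complex.enorm_exp_I_mul_ofReal, one_mul]

theorem continuous_extensionOp {g : ℝ → ℂ} (hg : Integrable g) :
    Continuous fun z : ℝ × ℝ => extensionOp g z.1 z.2 := by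
  refine continuous_of_dominated (bound := fun ω => ‖g ω‖) (fun z => ?_) (fun z => ?_) hg.norm ?_
  · exact Continuous.aestronglyMeasurable (by fun_prop) |>.mul hg.1
  · exact Eventually.of_forall fun ω => by
      rw [norm_mul, Complex.norm_exp_I_mul_ofReal, one_mul]
  · exact Eventually.of_forall fun ω => by fun_prop

theorem integrable_exp_mul {g : ℝ → ℂ} (hg : Integrable g) (x t : ℝ) :
    Integrable fun ω : ℝ => Complex.exp (Complex.I * ((ω ^ 2 * t + ω * x : ℝ) : ℂ)) * g ω :=
  hg.bdd_mul (c := 1) (Continuous.aestronglyMeasurable (by fun_prop))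
    (Eventually.of_forall fun _ => by rw [Complex.norm_exp_I_mul_ofReal])

theorem extensionOp_sum {ι : Type*} (s : Finset ι) {g : ι → ℝ → ℂ}
    (hg : ∀ i ∈ s, Integrable (g i)) (x t : ℝ) :
    extensionOp (fun ω => ∑ i ∈ s, g i ω) x t = ∑ i ∈ s, extensionOp (g i) x t := by
  simp only [extensionOp, Finset.mul_sum]
  exact integral_finsetSum _ fun i hi => integrable_exp_mul (hg i hi) x t

theorem extensionOp_sub {g h : ℝ → ℂ} (hg : Integrable g) (hh : Integrable h) (x t : ℝ) :
    extensionOp (fun ω => g ω - h ω) x t = extensionOp g x t - extensionOp h x t := by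
  simp only [extensionOp, mul_sub]
  exact integral_sub (integrable_exp_mul hg x t) (integrable_exp_mul hh x t)

theorem extensionOp_const_mul (a : ℂ) (g : ℝ → ℂ) (x t : ℝ) :
    extensionOp (fun ω => a * g ω) x t = a * extensionOp g x t := by
  simp only [extensionOp, ← integral_const_mul]
  exact integral_congr_ae (Eventually.of_forall fun ω => by ring)

end Extension

section Bilinear

theorem enorm_convolution_le {g h : ℝ → ℂ} (hg : MemLp g 2) (hh : MemLp h 2) (s : ℝ) :
    ‖(g ⋆[ContinuousLinearMap.mul ℂ ℂ] h) s‖ₑ ≤ eLpNorm g 2 * eLpNorm h 2 := by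
  have hsub := Measure.measurePreserving_sub_left (volume : Measure ℝ) s
  rw [← eLpNorm_comp_measurePreserving hh.1 hsub]
  exact (enorm_integral_le_lintegral_enorm fun ω => g ω * h (s - ω)).trans
    (lintegral_enorm_mul_le hg.1 (hh.1.comp_measurePreserving hsub))

theorem memLp_convolution {g h : ℝ → ℂ} (hg : Integrable g) (hg2 : MemLp g 2)
    (hh : Integrable h) (hh2 : MemLp h 2) :
    MemLp (g ⋆[ContinuousLinearMap.mul ℂ ℂ] h) 2 := by
  have hint := hg.integrable_convolution (ContinuousLinearMap.mul ℂ ℂ) hh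
  rw [memLp_two_iff_lintegral_lt_top hint.1]
  calc _ ≤ ∫⁻ s, eLpNorm g 2 * eLpNorm h 2 * ‖(g ⋆[ContinuousLinearMap.mul ℂ ℂ] h) s‖ₑ :=
        lintegral_mono fun s => by rw [sq]; gcongr; exact enorm_convolution_le hg2 hh2 s
    _ < ∞ := by
        rw [lintegral_const_mul' _ _ (ENNReal.mul_ne_top hg2.2.ne hh2.2.ne)]
        exact ENNReal.mul_lt_top (ENNReal.mul_lt_top hg2.2 hh2.2) hint.2

theorem extensionOp_mul_extensionOp {g h : ℝ → ℂ} (hg : Integrable g) (hh : Integrable h)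
    (x t : ℝ) : extensionOp g x t * extensionOp h x t =
      extensionOp (modulate t g ⋆[ContinuousLinearMap.mul ℂ ℂ] modulate t h) x 0 := by
  rw [extensionOp_eq_fourier, extensionOp_eq_fourier, extensionOp_eq_fourier, modulate_zero,
    Real.fourier_mul_convolution_eq (integrable_modulate t hg) (integrable_modulate t hh)]

theorem lintegral_extensionOp_mul_sq {g h : ℝ → ℂ} (hg : Integrable g) (hg2 : MemLp g 2)
    (hh : Integrable h) (hh2 : MemLp h 2) (t : ℝ) :
    ∫⁻ x, ‖extensionOp g x t * extensionOp h x t‖ₑ ^ 2 = ENNReal.ofReal (2 * Real.pi) *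
      ∫⁻ s, ‖(modulate t g ⋆[ContinuousLinearMap.mul ℂ ℂ] modulate t h) s‖ₑ ^ 2 := by
  have hg' := integrable_modulate t hg
  have hh' := integrable_modulate t hh
  simp_rw [extensionOp_mul_extensionOp hg hh]
  exact lintegral_extensionOp_sq (hg'.integrable_convolution _ hh')
    (memLp_convolution hg' (memLp_modulate t hg2) hh' (memLp_modulate t hh2)) 0

theorem convolution_modulate (t : ℝ) (g h : ℝ → ℂ) (s : ℝ) :
    (modulate t g ⋆[ContinuousLinearMap.mul ℂ ℂ] modulate t h) s =
      ∫ ω, Complex.exp (Complex.I * (((ω ^ 2 + (s - ω) ^ 2) * t : ℝ) : ℂ)) *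
        (g ω * h (s - ω)) := by
  refine integral_congr_ae (Eventually.of_forall fun ω => ?_)
  simp only [ContinuousLinearMap.mul_apply', modulate]
  rw [mul_mul_mul_comm, ← Complex.exp_add, add_mul, Complex.ofReal_add, mul_add]

section PhasePlancherel

variable {ψ ψ' : ℝ → ℝ} {S : Set ℝ} {G : ℝ → ℂ}

/-- The density of the image under `ψ : S → ℝ` of the complex measure `G dω`, where `ψ'` is the
derivative of `ψ`. -/
def pushDensity (ψ ψ' : ℝ → ℝ) (S : Set ℝ) (G : ℝ → ℂ) : ℝ → ℂ :=
  (ψ '' S).indicator fun y =>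
    ((|ψ' (Function.invFunOn ψ S y)| : ℝ) : ℂ)⁻¹ * G (Function.invFunOn ψ S y)

theorem pushDensity_apply (hinj : InjOn ψ S) {ω : ℝ} (hω : ω ∈ S) :
    pushDensity ψ ψ' S G (ψ ω) = ((|ψ' ω| : ℝ) : ℂ)⁻¹ * G ω := by
  rw [pushDensity, indicator_of_mem (mem_image_of_mem ψ hω), hinj.leftInvOn_invFunOn hω]

theorem integrable_pushDensity (hS : MeasurableSet S)
    (hψ : ∀ ω ∈ S, HasDerivWithinAt ψ (ψ' ω) S ω) (hinj : InjOn ψ S) (hψ' : ∀ ω ∈ S, ψ' ω ≠ 0)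
    (hG : Integrable G) : Integrable (pushDensity ψ ψ' S G) := by
  have hT : MeasurableSet (ψ '' S) :=
    measurable_image_of_fderivWithin hS (fun ω hω => (hψ ω hω).hasFDerivWithinAt) hinj
  have h : IntegrableOn (pushDensity ψ ψ' S G) (ψ '' S) := by
    rw [integrableOn_image_iff_integrableOn_abs_deriv_smul hS hψ hinj]
    refine hG.integrableOn.congr_fun (fun ω hω => ?_) hS
    rw [pushDensity_apply hinj hω, Complex.real_smul, mul_inv_cancel_left₀]
    exact_mod_cast abs_ne_zero.2 (hψ' ω hω)
  rw [← integrable_indicator_iff hT] at h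
  rwa [pushDensity, indicator_indicator, inter_self] at h

theorem integral_mul_pushDensity (hS : MeasurableSet S)
    (hψ : ∀ ω ∈ S, HasDerivWithinAt ψ (ψ' ω) S ω) (hinj : InjOn ψ S) (hψ' : ∀ ω ∈ S, ψ' ω ≠ 0)
    (hG : Function.support G ⊆ S) (e : ℝ → ℂ) :
    ∫ y, e y * pushDensity ψ ψ' S G y = ∫ ω, e (ψ ω) * G ω := by
  rw [← setIntegral_eq_integral_of_forall_compl_eq_zero (s := ψ '' S) fun y hy => by
      rw [pushDensity, indicator_of_notMem hy, mul_zero],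
    ← setIntegral_eq_integral_of_forall_compl_eq_zero (s := S) (f := fun ω => e (ψ ω) * G ω)
      fun ω hω => by rw [Function.notMem_support.1 fun h => hω (hG h), mul_zero],
    integral_image_eq_integral_abs_deriv_smul hS hψ hinj]
  refine setIntegral_congr_fun hS fun ω hω => ?_
  have h : ((|ψ' ω| : ℝ) : ℂ) ≠ 0 := by exact_mod_cast abs_ne_zero.2 (hψ' ω hω)
  simp only [pushDensity_apply hinj hω, Complex.real_smul]
  field_simp

theorem lintegral_pushDensity_sq_le (hS : MeasurableSet S)
    (hψ : ∀ ω ∈ S, HasDerivWithinAt ψ (ψ' ω) S ω) (hinj : InjOn ψ S) {β : ℝ} (hβ : 0 < β)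
    (hψ' : ∀ ω ∈ S, β ≤ |ψ' ω|) :
    ∫⁻ y, ‖pushDensity ψ ψ' S G y‖ₑ ^ 2 ≤ ENNReal.ofReal β⁻¹ * ∫⁻ ω, ‖G ω‖ₑ ^ 2 := by
  have hsupp : Function.support (fun y => ‖pushDensity ψ ψ' S G y‖ₑ ^ 2) ⊆ ψ '' S := by
    refine Function.support_subset_iff'.2 fun y hy => ?_
    simp [pushDensity, indicator_of_notMem hy]
  have hT : MeasurableSet (ψ '' S) :=
    measurable_image_of_fderivWithin hS (fun ω hω => (hψ ω hω).hasFDerivWithinAt) hinj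
  rw [← lintegral_congr fun y => congrFun (indicator_eq_self.2 hsupp) y, lintegral_indicator hT,
    lintegral_image_eq_lintegral_abs_deriv_mul hS hψ hinj,
    ← lintegral_const_mul' _ _ ENNReal.ofReal_ne_top]
  refine (setLIntegral_mono' hS fun ω hω => ?_).trans (setLIntegral_le_lintegral _ _)
  have h := hβ.trans_le (hψ' ω hω)
  have henorm : ‖((|ψ' ω| : ℝ) : ℂ)⁻¹‖ₑ = ENNReal.ofReal |ψ' ω|⁻¹ := by
    rw [← ofReal_norm, norm_inv, Complex.norm_real, Real.norm_eq_abs, abs_abs]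
  rw [pushDensity_apply hinj hω, enorm_mul, mul_pow, ← mul_assoc, henorm,
    ← ENNReal.ofReal_pow (by positivity), ← ENNReal.ofReal_mul h.le]
  gcongr
  rw [sq, mul_inv_cancel_left₀ h.ne']
  exact inv_anti₀ hβ (hψ' ω hω)

theorem lintegral_integral_exp_phase_sq_le (hS : MeasurableSet S)
    (hψ : ∀ ω ∈ S, HasDerivWithinAt ψ (ψ' ω) S ω) (hinj : InjOn ψ S) {β : ℝ} (hβ : 0 < β)
    (hψ' : ∀ ω ∈ S, β ≤ |ψ' ω|) (hG : Integrable G) (hsupp : Function.support G ⊆ S) :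
    ∫⁻ t : ℝ, ‖∫ ω, Complex.exp (Complex.I * ((ψ ω * t : ℝ) : ℂ)) * G ω‖ₑ ^ 2 ≤
      ENNReal.ofReal (2 * Real.pi / β) * ∫⁻ ω, ‖G ω‖ₑ ^ 2 := by
  rcases eq_or_ne (∫⁻ ω, ‖G ω‖ₑ ^ 2) ∞ with htop | htop
  · rw [htop, ENNReal.mul_top (by simpa using div_pos Real.two_pi_pos hβ)]
    exact le_top
  have hne (ω : ℝ) (hω : ω ∈ S) : ψ' ω ≠ 0 := abs_pos.1 (hβ.trans_le (hψ' ω hω))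
  have hle := lintegral_pushDensity_sq_le (G := G) hS hψ hinj hβ hψ'
  have hD := integrable_pushDensity hS hψ hinj hne hG
  have hD2 : MemLp (pushDensity ψ ψ' S G) 2 := (memLp_two_iff_lintegral_lt_top hD.1).2
    (hle.trans_lt (ENNReal.mul_lt_top ENNReal.ofReal_lt_top htop.lt_top))
  have hfourier (t : ℝ) : ∫ ω, Complex.exp (Complex.I * ((ψ ω * t : ℝ) : ℂ)) * G ω =
      extensionOp (pushDensity ψ ψ' S G) t 0 := by
    simp only [extensionOp, mul_zero, zero_add]
    exact (integral_mul_pushDensity hS hψ hinj hne hsupp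
      fun y => Complex.exp (Complex.I * ((y * t : ℝ) : ℂ))).symm
  simp_rw [hfourier]
  rw [lintegral_extensionOp_sq hD hD2, div_eq_mul_inv, ENNReal.ofReal_mul Real.two_pi_pos.le,
    mul_assoc]
  gcongr

end PhasePlancherel

/-- For fixed `s` the phase `ω² + (s - ω)²` has derivative `2 (ω - (s - ω)) ≥ 2 β` where
`g ω h (s - ω) ≠ 0`. -/
theorem lintegral_convolution_modulate_sq_le {g h : ℝ → ℂ} (hg : MemLp g 2) (hh : MemLp h 2)
    {β : ℝ} (hβ : 0 < β) (hsep : ∀ a b, g a ≠ 0 → h b ≠ 0 → b + β ≤ a) (s : ℝ) :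
    ∫⁻ t, ‖(modulate t g ⋆[ContinuousLinearMap.mul ℂ ℂ] modulate t h) s‖ₑ ^ 2 ≤
      ENNReal.ofReal (Real.pi / β) * ∫⁻ ω, ‖g ω * h (s - ω)‖ₑ ^ 2 := by
  have hderiv (ω : ℝ) : HasDerivAt (fun ω => ω ^ 2 + (s - ω) ^ 2) (2 * (2 * ω - s)) ω := by
    refine (((hasDerivAt_id ω).pow 2).add (((hasDerivAt_id ω).const_sub s).pow 2)).congr_deriv ?_
    simp
    ring
  have hinj : InjOn (fun ω => ω ^ 2 + (s - ω) ^ 2) (Ici ((s + β) / 2)) := by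
    intro a ha b hb hab
    simp only [mem_Ici] at ha hb
    have hfactor : (a - b) * (a + b - s) = 0 := by
      simp only at hab
      linarith
    exact sub_eq_zero.1 ((mul_eq_zero.1 hfactor).resolve_right (by linarith))
  have hh' : MemLp (fun ω => h (s - ω)) 2 :=
    hh.comp_measurePreserving (Measure.measurePreserving_sub_left volume s)
  simp_rw [convolution_modulate]
  refine (lintegral_integral_exp_phase_sq_le measurableSet_Ici
    (fun ω _ => (hderiv ω).hasDerivWithinAt) hinj (mul_pos two_pos hβ) (fun ω hω => ?_)
    (hg.integrable_mul hh') fun ω hω => ?_).trans_eq (by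
      rw [mul_div_mul_left _ _ two_ne_zero]
      rfl)
  · simp only [mem_Ici] at hω
    exact le_abs.2 (Or.inl (by linarith))
  · have := hsep ω (s - ω) (left_ne_zero_of_mul hω) (right_ne_zero_of_mul hω)
    simp only [mem_Ici]
    linarith

theorem lintegral_lintegral_mul_sub_sq {g h : ℝ → ℂ} (hg : AEStronglyMeasurable g)
    (hh : AEStronglyMeasurable h) :
    ∫⁻ s, ∫⁻ ω, ‖g ω * h (s - ω)‖ₑ ^ 2 = (∫⁻ ω, ‖g ω‖ₑ ^ 2) * ∫⁻ ω, ‖h ω‖ₑ ^ 2 := by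
  rw [lintegral_lintegral_swap
    ((hg.convolution_integrand (ContinuousLinearMap.mul ℂ ℂ) hh).enorm.pow_const 2),
    ← lintegral_mul_const'' _ (hg.enorm.pow_const 2)]
  refine lintegral_congr fun ω => ?_
  simp_rw [enorm_mul, mul_pow]
  rw [lintegral_const_mul' _ _ (by finiteness)]
  exact congrArg _ (lintegral_sub_right_eq_self (fun s => ‖h s‖ₑ ^ 2) ω)

theorem aestronglyMeasurable_convolution_modulate {g h : ℝ → ℂ} (hg : AEStronglyMeasurable g)
    (hh : AEStronglyMeasurable h) :
    AEStronglyMeasurable (fun p : ℝ × ℝ =>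
      (modulate p.1 g ⋆[ContinuousLinearMap.mul ℂ ℂ] modulate p.1 h) p.2)
      (volume.prod volume) := by
  have hq : Measure.QuasiMeasurePreserving (fun p : (ℝ × ℝ) × ℝ => (p.1.2, p.2))
      ((volume.prod volume).prod volume) (volume.prod volume) :=
    Measure.quasiMeasurePreserving_snd.comp
      (measurePreserving_prodAssoc volume volume volume).quasiMeasurePreserving
  have hamp : AEStronglyMeasurable (fun p : (ℝ × ℝ) × ℝ => g p.2 * h (p.1.2 - p.2))
      ((volume.prod volume).prod volume) :=
    (hg.convolution_integrand (ContinuousLinearMap.mul ℂ ℂ) hh).comp_quasiMeasurePreserving hq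
  have hphase : Continuous fun p : (ℝ × ℝ) × ℝ =>
      Complex.exp (Complex.I * (((p.2 ^ 2 + (p.1.2 - p.2) ^ 2) * p.1.1 : ℝ) : ℂ)) := by fun_prop
  simp_rw [convolution_modulate]
  exact (hphase.aestronglyMeasurable.mul hamp).integral_prod_right'

theorem lintegral_bilinear_le {g h : ℝ → ℂ} (hg : Integrable g) (hg2 : MemLp g 2)
    (hh : Integrable h) (hh2 : MemLp h 2) {β : ℝ} (hβ : 0 < β)
    (hsep : ∀ a b, g a ≠ 0 → h b ≠ 0 → b + β ≤ a) :
    ∫⁻ t, ∫⁻ x, ‖extensionOp g x t * extensionOp h x t‖ₑ ^ 2 ≤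
      ENNReal.ofReal (2 * Real.pi ^ 2 / β) * ((∫⁻ ω, ‖g ω‖ₑ ^ 2) * ∫⁻ ω, ‖h ω‖ₑ ^ 2) := by
  simp_rw [lintegral_extensionOp_mul_sq hg hg2 hh hh2]
  rw [lintegral_const_mul' _ _ ENNReal.ofReal_ne_top, lintegral_lintegral_swap
    ((aestronglyMeasurable_convolution_modulate hg.1 hh.1).enorm.pow_const 2)]
  calc _ ≤ ENNReal.ofReal (2 * Real.pi) * ∫⁻ s, ENNReal.ofReal (Real.pi / β) *
        ∫⁻ ω, ‖g ω * h (s - ω)‖ₑ ^ 2 := by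
        gcongr with s
        exact lintegral_convolution_modulate_sq_le hg2 hh2 hβ hsep s
    _ = _ := by
        rw [lintegral_const_mul' _ _ ENNReal.ofReal_ne_top,
          lintegral_lintegral_mul_sub_sq hg.1 hh.1, ← mul_assoc,
          ← ENNReal.ofReal_mul Real.two_pi_pos.le]
        congr 2
        ring

end Bilinear

section AlmostOrthogonality

theorem enorm_sum_sq_le_of_card_le {ι E : Type*} [SeminormedAddCommGroup E] [DecidableEq E]
    {P : Finset ι} {z : ι → E} {n : ℕ} (h : {a ∈ P | z a ≠ 0}.card ≤ n) :
    ‖∑ a ∈ P, z a‖ₑ ^ 2 ≤ n * ∑ a ∈ P, ‖z a‖ₑ ^ 2 := by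
  have key : ‖∑ a ∈ P, z a‖₊ ^ 2 ≤ n * ∑ a ∈ P, ‖z a‖₊ ^ 2 :=
    calc ‖∑ a ∈ P, z a‖₊ ^ 2 = ‖∑ a ∈ P with z a ≠ 0, z a‖₊ ^ 2 := by
          rw [Finset.sum_filter_ne_zero]
      _ ≤ (∑ a ∈ P with z a ≠ 0, ‖z a‖₊) ^ 2 := by gcongr; exact nnnorm_sum_le _ _
      _ ≤ {a ∈ P | z a ≠ 0}.card * ∑ a ∈ P with z a ≠ 0, ‖z a‖₊ ^ 2 := sq_sum_le_card_mul_sum_sq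
      _ ≤ n * ∑ a ∈ P, ‖z a‖₊ ^ 2 := by gcongr; exact Finset.filter_subset _ _
  simp only [enorm]
  exact_mod_cast key

theorem lintegral_enorm_sum_sq_le_of_card_le {ι α E : Type*} [MeasurableSpace α] {μ : Measure α}
    [SeminormedAddCommGroup E] [DecidableEq E] {P : Finset ι} {z : ι → α → E}
    (hz : ∀ a ∈ P, AEStronglyMeasurable (z a) μ) {n : ℕ}
    (h : ∀ x, {a ∈ P | z a x ≠ 0}.card ≤ n) :
    ∫⁻ x, ‖∑ a ∈ P, z a x‖ₑ ^ 2 ∂μ ≤ n * ∑ a ∈ P, ∫⁻ x, ‖z a x‖ₑ ^ 2 ∂μ := by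
  rw [← lintegral_finsetSum' _ fun a ha => (hz a ha).enorm.pow_const 2,
    ← lintegral_const_mul' _ _ (ENNReal.natCast_ne_top n)]
  exact lintegral_mono fun x => enorm_sum_sq_le_of_card_le (h x)

theorem exists_ne_zero_of_convolution_modulate_ne_zero {g h : ℝ → ℂ} {t s : ℝ}
    (hs : (modulate t g ⋆[ContinuousLinearMap.mul ℂ ℂ] modulate t h) s ≠ 0) :
    ∃ ω, g ω ≠ 0 ∧ h (s - ω) ≠ 0 := by
  contrapose! hs
  rw [convolution_modulate]
  refine integral_eq_zero_of_ae (Eventually.of_forall fun ω => ?_)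
  by_cases hω : g ω = 0
  · simp [hω]
  · simp [hs ω hω]

theorem lintegral_sum_extensionOp_mul_sq_le {ι : Type*} {P : Finset ι} {g h : ι → ℝ → ℂ}
    (hg : ∀ p, Integrable (g p)) (hg2 : ∀ p, MemLp (g p) 2) (hh : ∀ p, Integrable (h p))
    (hh2 : ∀ p, MemLp (h p) 2) {n : ℕ} {t : ℝ}
    (hcard : ∀ s, {p ∈ P |
      (modulate t (g p) ⋆[ContinuousLinearMap.mul ℂ ℂ] modulate t (h p)) s ≠ 0}.card ≤ n) :
    ∫⁻ x, ‖∑ p ∈ P, extensionOp (g p) x t * extensionOp (h p) x t‖ₑ ^ 2 ≤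
      n * ∑ p ∈ P, ∫⁻ x, ‖extensionOp (g p) x t * extensionOp (h p) x t‖ₑ ^ 2 := by
  set G : ι → ℝ → ℂ := fun p =>
    modulate t (g p) ⋆[ContinuousLinearMap.mul ℂ ℂ] modulate t (h p)
  have hG (p) : Integrable (G p) :=
    (integrable_modulate t (hg p)).integrable_convolution _ (integrable_modulate t (hh p))
  have hG2 (p) : MemLp (G p) 2 :=
    memLp_convolution (integrable_modulate t (hg p)) (memLp_modulate t (hg2 p))
      (integrable_modulate t (hh p)) (memLp_modulate t (hh2 p))
  have heq (x) : ∑ p ∈ P, extensionOp (g p) x t * extensionOp (h p) x t =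
      extensionOp (fun s => ∑ p ∈ P, G p s) x 0 := by
    rw [extensionOp_sum P fun p _ => hG p]
    exact Finset.sum_congr rfl fun p _ => extensionOp_mul_extensionOp (hg p) (hh p) x t
  have hsum : Integrable fun s => ∑ p ∈ P, G p s := integrable_finsetSum _ fun p _ => hG p
  have hsum2 : MemLp (fun s => ∑ p ∈ P, G p s) 2 := memLp_finsetSum _ fun p _ => hG2 p
  simp_rw [heq, lintegral_extensionOp_sq hsum hsum2,
    lintegral_extensionOp_mul_sq (hg _) (hg2 _) (hh _) (hh2 _)]
  rw [← Finset.mul_sum, mul_left_comm]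
  gcongr
  exact lintegral_enorm_sum_sq_le_of_card_le (fun p _ => (hG p).1) hcard

theorem card_pairs_le {P : Finset (ℤ × ℤ)} (hP : ∀ p ∈ P, |p.1 - p.2| ≤ 3) (a : ℤ) :
    {p ∈ P | p.1 + p.2 ∈ Finset.Icc a (a + 3)}.card ≤ 28 :=
  calc _ ≤ (Finset.Icc a (a + 3) ×ˢ Finset.Icc (-3 : ℤ) 3).card := by
        refine Finset.card_le_card_of_injOn (fun p => (p.1 + p.2, p.1 - p.2)) (fun p hp => ?_)
          (fun p _ p' _ h => ?_)
        · rw [Finset.mem_coe, Finset.mem_filter] at hp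
          exact Finset.mem_product.2 ⟨hp.2, Finset.mem_Icc.2 (abs_le.1 (hP p hp.1))⟩
        · simp only [Prod.mk.injEq] at h
          ext <;> omega
    _ = 28 := by
        rw [Finset.card_product, Int.card_Icc, Int.card_Icc, add_assoc, add_sub_cancel_left]
        rfl

theorem add_mem_Icc_ceil {n : ℕ} (hn : 8 ≤ n) {i j : ℤ} {y : ℝ}
    (h1 : (n * (i + j) - 6 : ℝ) ≤ y) (h2 : y ≤ n * (i + j) + 2 * n + 4) :
    i + j ∈ Finset.Icc ⌈(y - 2 * n - 4) / n⌉ (⌈(y - 2 * n - 4) / n⌉ + 3) := by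
  have hn8 : (8 : ℝ) ≤ n := by exact_mod_cast hn
  have hn0 : (0 : ℝ) < n := by linarith
  rw [Finset.mem_Icc, Int.ceil_le, ← sub_le_iff_le_add, Int.le_ceil_iff, div_le_iff₀ hn0,
    lt_div_iff₀ hn0]
  push_cast
  constructor <;> nlinarith

theorem lintegral_sum_neighbours_sq_le {g : ℤ → ℝ → ℂ} (hg : ∀ i, Integrable (g i))
    (hg2 : ∀ i, MemLp (g i) 2) {n : ℕ} (hn : 8 ≤ n) {r : ℝ}
    (hsupp : ∀ i ω, g i ω ≠ 0 → (n * i - 3 : ℝ) ≤ ω * r ∧ ω * r ≤ n * i + n + 2)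
    {P : Finset (ℤ × ℤ)} (hP : ∀ p ∈ P, |p.1 - p.2| ≤ 3) (t : ℝ) :
    ∫⁻ x, ‖∑ p ∈ P, extensionOp (g p.1) x t * extensionOp (g p.2) x t‖ₑ ^ 2 ≤
      28 * ∑ p ∈ P, ∫⁻ x, ‖extensionOp (g p.1) x t * extensionOp (g p.2) x t‖ₑ ^ 2 := by
  have hcard (s) : {p ∈ P | (modulate t (g p.1) ⋆[ContinuousLinearMap.mul ℂ ℂ]
      modulate t (g p.2)) s ≠ 0}.card ≤ 28 := by
    refine (Finset.card_le_card ?_).trans (card_pairs_le hP ⌈(s * r - 2 * n - 4) / n⌉)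
    refine Finset.monotone_filter_right P fun p _ hne => ?_
    obtain ⟨ω, h1, h2⟩ := exists_ne_zero_of_convolution_modulate_ne_zero hne
    have hω := hsupp _ _ h1
    have hsω := hsupp _ _ h2
    exact add_mem_Icc_ceil hn (by linarith) (by linarith)
  have key := lintegral_sum_extensionOp_mul_sq_le (fun p : ℤ × ℤ => hg p.1) (fun p => hg2 p.1)
    (fun p => hg p.2) (fun p => hg2 p.2) hcard
  rwa [Nat.cast_ofNat] at key

end AlmostOrthogonality

section Majorant

/-- The weight `(1 + |y|)⁻²`, to which a packet decays at distance `y R^{1/2}` from its line. -/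
def wt (y : ℝ) : ℝ := ((1 + |y|) ^ 2)⁻¹

theorem wt_pos (y : ℝ) : 0 < wt y := by unfold wt; positivity

theorem continuous_wt : Continuous wt := by
  unfold wt
  exact Continuous.inv₀ (by fun_prop) fun y => by positivity

theorem summable_wt_int : Summable fun n : ℤ => wt n := by
  refine ((Real.summable_one_div_int_pow (p := 2)).2 one_lt_two).of_norm_bounded_eventually ?_
  filter_upwards [(Set.finite_singleton (0 : ℤ)).compl_mem_cofinite] with n hn
  have hn0 : (n : ℝ) ≠ 0 := by exact_mod_cast hn
  rw [Real.norm_of_nonneg (wt_pos _).le, wt, one_div]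
  refine inv_anti₀ (by positivity) ?_
  rw [← sq_abs (n : ℝ)]
  gcongr
  linarith

/-- A bound for the sums of `wt` over translates of `ℤ`. -/
def wtSum : ℝ := 4 * ∑' n : ℤ, wt n

theorem wtSum_nonneg : 0 ≤ wtSum := mul_nonneg (by norm_num) (tsum_nonneg fun _ => (wt_pos _).le)

theorem wt_sub_intCast_le (y : ℝ) (m : ℤ) : wt (y - m) ≤ 4 * wt ((m - ⌊y⌋ : ℤ) : ℝ) := by
  have hfloor : |((m - ⌊y⌋ : ℤ) : ℝ)| ≤ |y - m| + 1 := by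
    push_cast
    rw [abs_le]
    constructor <;> linarith [Int.floor_le y, Int.lt_floor_add_one y, neg_abs_le (y - m),
      le_abs_self (y - m)]
  have hle : (1 + |((m - ⌊y⌋ : ℤ) : ℝ)|) ^ 2 ≤ (2 * (1 + |y - m|)) ^ 2 := by
    gcongr
    linarith [abs_nonneg (y - m)]
  unfold wt
  rw [← div_eq_mul_inv, le_div_iff₀ (by positivity), inv_mul_le_iff₀ (by positivity)]
  linarith

theorem sum_wt_le (u : Finset ℤ) (y : ℝ) : ∑ m ∈ u, wt (y - m) ≤ wtSum :=
  calc _ ≤ ∑ m ∈ u, 4 * wt ((m - ⌊y⌋ : ℤ) : ℝ) :=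
        Finset.sum_le_sum fun m _ => wt_sub_intCast_le y m
    _ = 4 * ∑ n ∈ u.map (Equiv.subRight ⌊y⌋).toEmbedding, wt n := by
        rw [← Finset.mul_sum, Finset.sum_map]
        rfl
    _ ≤ wtSum := by
        unfold wtSum
        gcongr
        exact summable_wt_int.sum_le_tsum _ fun _ _ => (wt_pos _).le

theorem lintegral_wt_le {r : ℝ} (hr : 0 < r) (a : ℝ) :
    ∫⁻ x, ENNReal.ofReal (wt (x / r - a)) ≤ ENNReal.ofReal (Real.pi * r) := by
  have hle : ∀ y, wt y ≤ (1 + y ^ 2)⁻¹ := by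
    intro y
    unfold wt
    gcongr
    rw [← sq_abs y]
    nlinarith [abs_nonneg y]
  have hI : Integrable fun x : ℝ => (1 + (x / r - a) ^ 2)⁻¹ :=
    (integrable_inv_one_add_sq.comp_sub_right a).comp_div hr.ne'
  have hval : ∫ x : ℝ, (1 + (x / r - a) ^ 2)⁻¹ = Real.pi * r := by
    rw [Measure.integral_comp_div (fun x : ℝ => (1 + (x - a) ^ 2)⁻¹) r,
      integral_sub_right_eq_self (fun x : ℝ => (1 + x ^ 2)⁻¹) a, integral_univ_inv_one_add_sq,
      abs_of_pos hr, smul_eq_mul, mul_comm]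
  calc _ ≤ ∫⁻ x, ENNReal.ofReal ((1 + (x / r - a) ^ 2)⁻¹) :=
        lintegral_mono fun x => ENNReal.ofReal_le_ofReal (hle _)
    _ = _ := by
        rw [← ofReal_integral_eq_lintegral_ofReal hI
          (Eventually.of_forall fun x => by positivity), hval]

variable {R : ℝ} (c : Index R → ℂ) {u : Finset (Index R)} {κ : Finset ℤ}

/-- The pointwise majorant `∑ |c_q| (1 + |X - m + 2kT|)^{-2}` of a sum of wave packets with indices
`q = (k, m)`, in the normalised coordinates `X = x R^{-1/2}` and `T = t R^{-1}`. -/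
def majorant (u : Finset (Index R)) (X T : ℝ) : ℝ :=
  ∑ q ∈ u, ‖c q‖ * wt (X - q.2 + 2 * (q.1 : ℤ) * T)

theorem majorant_nonneg (u : Finset (Index R)) (X T : ℝ) : 0 ≤ majorant c u X T :=
  Finset.sum_nonneg fun _ _ => mul_nonneg (norm_nonneg _) (wt_pos _).le

theorem majorant_mono {v : Finset (Index R)} (h : u ⊆ v) (X T : ℝ) :
    majorant c u X T ≤ majorant c v X T :=
  Finset.sum_le_sum_of_subset_of_nonneg h fun _ _ _ => mul_nonneg (norm_nonneg _) (wt_pos _).le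

theorem continuous_majorant (u : Finset (Index R)) {f g : ℝ × ℝ → ℝ}
    (hf : Continuous f) (hg : Continuous g) : Continuous fun z => majorant c u (f z) (g z) := by
  unfold majorant
  refine continuous_finsetSum _ fun q _ => continuous_const.mul (continuous_wt.comp ?_)
  fun_prop

theorem sum_wt_packets_le (hu : ∀ q ∈ u, (q.1 : ℤ) ∈ κ) (X T : ℝ) :
    ∑ q ∈ u, wt (X - q.2 + 2 * (q.1 : ℤ) * T) ≤ κ.card * wtSum := by
  classical
  have hinj : Function.Injective fun q : Index R => ((q.1 : ℤ), q.2) :=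
    Subtype.val_injective.prodMap Function.injective_id
  have hsub : u.image (fun q => ((q.1 : ℤ), q.2)) ⊆ κ ×ˢ u.image Prod.snd :=
    Finset.image_subset_iff.2 fun q hq =>
      Finset.mem_product.2 ⟨hu q hq, Finset.mem_image_of_mem _ hq⟩
  calc _ = ∑ p ∈ u.image (fun q => ((q.1 : ℤ), q.2)), wt (X - p.2 + 2 * p.1 * T) :=
        (Finset.sum_image hinj.injOn).symm
    _ ≤ ∑ p ∈ κ ×ˢ u.image Prod.snd, wt (X - p.2 + 2 * p.1 * T) :=
        Finset.sum_le_sum_of_subset_of_nonneg hsub fun _ _ _ => (wt_pos _).le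
    _ = ∑ k ∈ κ, ∑ m ∈ u.image Prod.snd, wt (X + 2 * k * T - m) := by
        rw [Finset.sum_product]
        refine Finset.sum_congr rfl fun k _ => Finset.sum_congr rfl fun m _ => ?_
        congr 1
        ring
    _ ≤ ∑ _k ∈ κ, wtSum := Finset.sum_le_sum fun k _ => sum_wt_le _ _
    _ = κ.card * wtSum := by rw [Finset.sum_const, nsmul_eq_mul]

variable {c}

theorem majorant_le (hu : ∀ q ∈ u, (q.1 : ℤ) ∈ κ) {b : ℝ} (hb : 0 ≤ b)
    (hc : ∀ q ∈ u, ‖c q‖ ≤ b) (X T : ℝ) : majorant c u X T ≤ b * (κ.card * wtSum) :=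
  calc _ ≤ ∑ q ∈ u, b * wt (X - q.2 + 2 * (q.1 : ℤ) * T) :=
        Finset.sum_le_sum fun q hq => mul_le_mul_of_nonneg_right (hc q hq) (wt_pos _).le
    _ ≤ _ := by
        rw [← Finset.mul_sum]
        gcongr
        exact sum_wt_packets_le hu X T

variable (c)

theorem majorant_sq_le (hu : ∀ q ∈ u, (q.1 : ℤ) ∈ κ) (X T : ℝ) :
    majorant c u X T ^ 2 ≤
      κ.card * wtSum * ∑ q ∈ u, ‖c q‖ ^ 2 * wt (X - q.2 + 2 * (q.1 : ℤ) * T) := by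
  have hnonneg (q : Index R) : 0 ≤ ‖c q‖ ^ 2 * wt (X - q.2 + 2 * (q.1 : ℤ) * T) :=
    mul_nonneg (sq_nonneg _) (wt_pos _).le
  refine (Finset.sum_sq_le_sum_mul_sum_of_sq_le_mul u (fun _ _ => (wt_pos _).le)
    (fun q _ => hnonneg q) fun _ _ => le_of_eq (by ring)).trans ?_
  exact mul_le_mul_of_nonneg_right (sum_wt_packets_le hu X T)
    (Finset.sum_nonneg fun q _ => hnonneg q)

theorem lintegral_majorant_sq_le (hu : ∀ q ∈ u, (q.1 : ℤ) ∈ κ) {r : ℝ} (hr : 0 < r) (T : ℝ) :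
    ∫⁻ x, ENNReal.ofReal (majorant c u (x / r) T ^ 2) ≤
      ENNReal.ofReal (κ.card * wtSum * (Real.pi * r) * ∑ q ∈ u, ‖c q‖ ^ 2) := by
  have hW : 0 ≤ κ.card * wtSum := mul_nonneg (Nat.cast_nonneg _) wtSum_nonneg
  have hwt (q : Index R) : Measurable fun x : ℝ =>
      ENNReal.ofReal (wt (x / r - (q.2 - 2 * (q.1 : ℤ) * T))) :=
    (continuous_wt.comp (by fun_prop)).measurable.ennreal_ofReal
  calc _ ≤ ∫⁻ x, ENNReal.ofReal (κ.card * wtSum) * ∑ q ∈ u, ENNReal.ofReal (‖c q‖ ^ 2) *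
          ENNReal.ofReal (wt (x / r - (q.2 - 2 * (q.1 : ℤ) * T))) := by
        refine lintegral_mono fun x => (ENNReal.ofReal_le_ofReal
          (majorant_sq_le c hu (x / r) T)).trans_eq ?_
        rw [ENNReal.ofReal_mul hW, ENNReal.ofReal_sum_of_nonneg
          (fun _ _ => mul_nonneg (sq_nonneg _) (wt_pos _).le)]
        simp_rw [ENNReal.ofReal_mul (sq_nonneg _), sub_sub_eq_add_sub, sub_add_eq_add_sub]
    _ = ENNReal.ofReal (κ.card * wtSum) * ∑ q ∈ u, ENNReal.ofReal (‖c q‖ ^ 2) *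
          ∫⁻ x, ENNReal.ofReal (wt (x / r - (q.2 - 2 * (q.1 : ℤ) * T))) := by
        rw [lintegral_const_mul' _ _ ENNReal.ofReal_ne_top,
          lintegral_finsetSum _ fun q _ => (hwt q).const_mul _]
        simp_rw [lintegral_const_mul' _ _ ENNReal.ofReal_ne_top]
    _ ≤ ENNReal.ofReal (κ.card * wtSum) * ∑ q ∈ u, ENNReal.ofReal (‖c q‖ ^ 2) *
          ENNReal.ofReal (Real.pi * r) := by
        gcongr
        exact lintegral_wt_le hr _
    _ = _ := by
        rw [← Finset.sum_mul, ← ENNReal.ofReal_sum_of_nonneg (fun _ _ => sq_nonneg _),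
          ← ENNReal.ofReal_mul (Finset.sum_nonneg fun _ _ => sq_nonneg _),
          ← ENNReal.ofReal_mul hW]
        congr 1
        ring

end Majorant

section PacketFamily

variable {R : ℝ} {K : ℕ → ℝ} {φ : Index R → ℝ → ℂ}

/-- The properties of an individual wave packet that the estimates use, in the normalised
coordinates `X = x R^{-1/2}`, `T = t R^{-1}`, in which the packet `(k, m)` has frequency `k` and
travels along the line `X = m - 2 k T`. -/
structure IsPacketFamily (R : ℝ) (K : ℕ → ℝ) (φ : Index R → ℝ → ℂ) : Prop where
  radius_pos : 0 < R
  memLp : ∀ q, MemLp (φ q) 2 volume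
  support : ∀ q ω, φ q ω ≠ 0 → |ω * √R - (q.1 : ℤ)| ≤ 3
  decay : ∀ q, ∀ N : ℕ, 0 < N → ∀ x t : ℝ, |t| ≤ R → ‖extensionOp (φ q) x t‖ ≤
    K N * R ^ (-(1 / 4) : ℝ) / (1 + |x / √R - q.2 + 2 * (q.1 : ℤ) * (t / R)|) ^ N

/-- The partial sum `∑_{q ∈ u} f_q` of a wave packet decomposition. -/
def packetSum (c : Index R → ℂ) (φ : Index R → ℝ → ℂ) (u : Finset (Index R)) : ℝ → ℂ :=
  fun ω => ∑ q ∈ u, packet c φ q ω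

/-- The extension `E(∑_{q ∈ u} f_q)` of a partial sum, as a function of `z = (x, t)`. -/
abbrev wave (c : Index R → ℂ) (φ : Index R → ℝ → ℂ) (u : Finset (Index R)) (z : ℝ × ℝ) : ℂ :=
  extensionOp (packetSum c φ u) z.1 z.2

theorem packetSum_eq_sum_packetSum_fiber {ι : Type*} [DecidableEq ι] (c : Index R → ℂ)
    (φ : Index R → ℝ → ℂ) {u : Finset (Index R)} {s : Finset ι} {f : Index R → ι}
    (hf : ∀ q ∈ u, f q ∈ s) (ω : ℝ) :
    packetSum c φ u ω = ∑ i ∈ s, packetSum c φ {q ∈ u | f q = i} ω :=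
  (Finset.sum_fiberwise_of_maps_to hf _).symm

theorem rpow_neg_quarter_sq (hR : 0 < R) : (R ^ (-(1 / 4) : ℝ)) ^ 2 = (√R)⁻¹ := by
  rw [← Real.rpow_natCast, ← Real.rpow_mul hR.le, Real.sqrt_eq_rpow, ← Real.rpow_neg hR.le]
  norm_num

/-- The constant in Bessel's inequality `‖∑ c_q φ_q‖² ≤ besselConst K * ∑ |c_q|²`: the factor `7`
is the overlap of the frequency supports. -/
def besselConst (K : ℕ → ℝ) : ℝ := 7 * (K 2 ^ 2 * wtSum / 2)

theorem besselConst_nonneg (K : ℕ → ℝ) : 0 ≤ besselConst K := by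
  have := wtSum_nonneg
  unfold besselConst
  positivity

namespace IsPacketFamily

theorem nonneg_const (hφ : IsPacketFamily R K φ) {N : ℕ} (hN : 0 < N) : 0 ≤ K N := by
  have hdecay := (norm_nonneg _).trans (hφ.decay (⟨0, by simp⟩, 0) N hN 0 0
    (by simpa using hφ.radius_pos.le))
  have hpow : 0 < R ^ (-(1 / 4) : ℝ) := Real.rpow_pos_of_pos hφ.radius_pos _
  simp only [zero_div, mul_zero, Int.cast_zero, sub_zero, add_zero, abs_zero, one_pow,
    div_one] at hdecay
  exact nonneg_of_mul_nonneg_left hdecay hpow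

theorem integrable (hφ : IsPacketFamily R K φ) (q : Index R) : Integrable (φ q) := by
  have hr : 0 < √R := Real.sqrt_pos.2 hφ.radius_pos
  refine integrable_of_ae_eq_zero_compl (hφ.memLp q) measurableSet_Icc
    (S := Icc (((q.1 : ℤ) - 3) / √R) (((q.1 : ℤ) + 3) / √R)) measure_Icc_lt_top.ne
    (ae_restrict_of_forall_mem measurableSet_Icc.compl fun ω hω => by_contra fun hne => hω ?_)
  have := abs_le.1 (hφ.support q ω hne)
  rw [mem_Icc, div_le_iff₀ hr, le_div_iff₀ hr]
  constructor <;> linarith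

theorem integrable_packetSum (hφ : IsPacketFamily R K φ) (c : Index R → ℂ)
    (u : Finset (Index R)) : Integrable (packetSum c φ u) :=
  integrable_finsetSum _ fun q _ => (hφ.integrable q).const_mul _

theorem memLp_packetSum (hφ : IsPacketFamily R K φ) (c : Index R → ℂ)
    (u : Finset (Index R)) : MemLp (packetSum c φ u) 2 :=
  memLp_finsetSum _ fun q _ => (hφ.memLp q).const_mul _

theorem continuous_wave (hφ : IsPacketFamily R K φ) (c : Index R → ℂ) (u : Finset (Index R)) :
    Continuous (wave c φ u) :=
  continuous_extensionOp (hφ.integrable_packetSum c u)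

theorem wave_eq_sum (hφ : IsPacketFamily R K φ) (c : Index R → ℂ) (u : Finset (Index R))
    (z : ℝ × ℝ) : wave c φ u z = ∑ q ∈ u, c q * extensionOp (φ q) z.1 z.2 := by
  unfold wave packetSum
  rw [extensionOp_sum u fun q _ => show Integrable (packet c φ q) from
    (hφ.integrable q).const_mul _]
  exact Finset.sum_congr rfl fun q _ => extensionOp_const_mul _ _ _ _

theorem norm_wave_le_of_far (hφ : IsPacketFamily R K φ) (c : Index R → ℂ)
    {u : Finset (Index R)} {z : ℝ × ℝ} (hz : |z.2| ≤ R) (N : ℕ) {ρ : ℝ} (hρ : 0 < ρ)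
    (hu : ∀ q ∈ u, ρ ≤ 1 + |z.1 / √R - q.2 + 2 * (q.1 : ℤ) * (z.2 / R)|) :
    ‖wave c φ u z‖ ≤
      K (N + 2) * R ^ (-(1 / 4) : ℝ) * (ρ ^ N)⁻¹ * majorant c u (z.1 / √R) (z.2 / R) := by
  rw [hφ.wave_eq_sum, majorant, Finset.mul_sum]
  refine (norm_sum_le _ _).trans (Finset.sum_le_sum fun q hq => ?_)
  set D := |z.1 / √R - q.2 + 2 * (q.1 : ℤ) * (z.2 / R)| with hD
  have hK := hφ.nonneg_const (N := N + 2) (by lia)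
  have hpow : 0 < R ^ (-(1 / 4) : ℝ) := Real.rpow_pos_of_pos hφ.radius_pos _
  rw [norm_mul]
  calc _ ≤ ‖c q‖ * (K (N + 2) * R ^ (-(1 / 4) : ℝ) / (1 + D) ^ (N + 2)) := by
        gcongr
        exact hφ.decay q (N + 2) (by lia) z.1 z.2 hz
    _ = ‖c q‖ * (K (N + 2) * R ^ (-(1 / 4) : ℝ) * ((1 + D) ^ N)⁻¹ * ((1 + D) ^ 2)⁻¹) := by
        rw [pow_add]
        field_simp
    _ ≤ ‖c q‖ * (K (N + 2) * R ^ (-(1 / 4) : ℝ) * (ρ ^ N)⁻¹ * ((1 + D) ^ 2)⁻¹) := by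
        gcongr
        exact hu q hq
    _ = _ := by
        rw [wt, ← hD]
        ring

theorem norm_wave_le (hφ : IsPacketFamily R K φ) (c : Index R → ℂ) (u : Finset (Index R))
    {z : ℝ × ℝ} (hz : |z.2| ≤ R) :
    ‖wave c φ u z‖ ≤ K 2 * R ^ (-(1 / 4) : ℝ) * majorant c u (z.1 / √R) (z.2 / R) := by
  simpa using hφ.norm_wave_le_of_far c hz 0 one_pos fun q _ =>
    le_add_of_nonneg_right (abs_nonneg _)

theorem lintegral_wave_sq_le (hφ : IsPacketFamily R K φ) (c : Index R → ℂ)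
    {u : Finset (Index R)} {κ : Finset ℤ} (hu : ∀ q ∈ u, (q.1 : ℤ) ∈ κ) {t : ℝ} (ht : |t| ≤ R) :
    ∫⁻ x, ‖wave c φ u (x, t)‖ₑ ^ 2 ≤
      ENNReal.ofReal (K 2 ^ 2 * (κ.card * wtSum * Real.pi) * ∑ q ∈ u, ‖c q‖ ^ 2) := by
  have hr : 0 < √R := Real.sqrt_pos.2 hφ.radius_pos
  calc _ ≤ ∫⁻ x, ENNReal.ofReal (K 2 ^ 2 * (√R)⁻¹) *
        ENNReal.ofReal (majorant c u (x / √R) (t / R) ^ 2) := by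
        refine lintegral_mono fun x => ?_
        rw [← ofReal_norm, ← ENNReal.ofReal_pow (norm_nonneg _),
          ← ENNReal.ofReal_mul (by positivity), ← rpow_neg_quarter_sq hφ.radius_pos, ← mul_pow,
          ← mul_pow]
        gcongr
        exact hφ.norm_wave_le c u ht
    _ ≤ ENNReal.ofReal (K 2 ^ 2 * (√R)⁻¹) * ENNReal.ofReal
        (κ.card * wtSum * (Real.pi * √R) * ∑ q ∈ u, ‖c q‖ ^ 2) := by
        rw [lintegral_const_mul' _ _ ENNReal.ofReal_ne_top]
        gcongr
        exact lintegral_majorant_sq_le c hu hr _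
    _ = _ := by
        rw [← ENNReal.ofReal_mul (by positivity)]
        congr 1
        field_simp

theorem lintegral_packetSum_sq_le_of_freq_eq (hφ : IsPacketFamily R K φ) (c : Index R → ℂ)
    {u : Finset (Index R)} {k : ℤ} (hu : ∀ q ∈ u, (q.1 : ℤ) = k) :
    ∫⁻ ω, ‖packetSum c φ u ω‖ₑ ^ 2 ≤
      ENNReal.ofReal (K 2 ^ 2 * wtSum / 2 * ∑ q ∈ u, ‖c q‖ ^ 2) := by
  have hpi : ENNReal.ofReal (2 * Real.pi) ≠ 0 := by simp [Real.pi_pos]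
  refine (ENNReal.mul_le_mul_iff_right hpi ENNReal.ofReal_ne_top).1 ?_
  rw [← lintegral_extensionOp_sq (hφ.integrable_packetSum c u) (hφ.memLp_packetSum c u) 0,
    ← ENNReal.ofReal_mul Real.two_pi_pos.le]
  refine (hφ.lintegral_wave_sq_le c (κ := {k}) (by simpa using hu)
    (by simpa using hφ.radius_pos.le)).trans_eq ?_
  rw [Finset.card_singleton]
  congr 1
  push_cast
  ring

theorem card_freq_packetSum_ne_zero_le (hφ : IsPacketFamily R K φ) (c : Index R → ℂ)
    (u : Finset (Index R)) (κ : Finset ℤ) (ω : ℝ) :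
    {k ∈ κ | packetSum c φ {q ∈ u | (q.1 : ℤ) = k} ω ≠ 0}.card ≤ 7 :=
  calc _ ≤ (Finset.Icc ⌈ω * √R - 3⌉ (⌈ω * √R - 3⌉ + 6)).card := by
        refine Finset.card_le_card fun k hk => ?_
        obtain ⟨q, hq, hqne⟩ := Finset.exists_ne_zero_of_sum_ne_zero (Finset.mem_filter.1 hk).2
        have hsupp := abs_le.1 (hφ.support q ω (right_ne_zero_of_mul hqne))
        rw [(Finset.mem_filter.1 hq).2] at hsupp
        rw [Finset.mem_Icc, Int.ceil_le, ← sub_le_iff_le_add, Int.le_ceil_iff]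
        push_cast
        constructor <;> linarith
    _ = 7 := by
        rw [Int.card_Icc]
        lia

theorem lintegral_packetSum_sq_le (hφ : IsPacketFamily R K φ) (c : Index R → ℂ)
    (u : Finset (Index R)) :
    ∫⁻ ω, ‖packetSum c φ u ω‖ₑ ^ 2 ≤ ENNReal.ofReal (besselConst K * ∑ q ∈ u, ‖c q‖ ^ 2) := by
  classical
  have hW := wtSum_nonneg
  set κ : Finset ℤ := u.image fun q => (q.1 : ℤ)
  have hκ : ∀ q ∈ u, (q.1 : ℤ) ∈ κ := fun q hq => Finset.mem_image_of_mem _ hq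
  calc _ = ∫⁻ ω, ‖∑ k ∈ κ, packetSum c φ {q ∈ u | (q.1 : ℤ) = k} ω‖ₑ ^ 2 := by
        simp_rw [packetSum_eq_sum_packetSum_fiber c φ hκ]
    _ ≤ (7 : ℕ) * ∑ k ∈ κ, ∫⁻ ω, ‖packetSum c φ {q ∈ u | (q.1 : ℤ) = k} ω‖ₑ ^ 2 :=
        lintegral_enorm_sum_sq_le_of_card_le (fun k _ => (hφ.memLp_packetSum c _).1)
          fun ω => hφ.card_freq_packetSum_ne_zero_le c u κ ω
    _ ≤ (7 : ℕ) * ∑ k ∈ κ, ENNReal.ofReal (K 2 ^ 2 * wtSum / 2 *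
          ∑ q ∈ u with (q.1 : ℤ) = k, ‖c q‖ ^ 2) := by
        gcongr with k _
        exact hφ.lintegral_packetSum_sq_le_of_freq_eq c fun q hq => (Finset.mem_filter.1 hq).2
    _ = _ := by
        rw [← ENNReal.ofReal_sum_of_nonneg fun k _ => by positivity, ← Finset.mul_sum,
          Finset.sum_fiberwise_of_maps_to hκ, ← ENNReal.ofReal_natCast,
          ← ENNReal.ofReal_mul (by positivity), besselConst, mul_assoc]
        norm_num

end IsPacketFamily

end PacketFamily

section CellPairs

variable {R : ℝ} {K : ℕ → ℝ} {φ : Index R → ℝ → ℂ} {c : Index R → ℂ} {s : Finset (Index R)}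
  {n : ℕ} {ρ b H : ℝ}

section Cells

/-- The packets of `s` whose frequency index lies in the `i`-th interval of length `n`. -/
def cell (n : ℕ) (s : Finset (Index R)) (i : ℤ) : Finset (Index R) :=
  {q ∈ s | (q.1 : ℤ) / (n : ℤ) = i}

/-- The indices `j` of the spatial intervals `[n j, n j + n)` that are within `ρ + 9` lengths of
`m`. A packet `(k, m)` with `k` within `4 n` of `n i` drifts by at most `8` lengths relative to
the line of slope `n i`, so `9` leaves room for one further rounding. -/
def nearIndices (n : ℕ) (ρ : ℝ) (m : ℤ) : Finset ℤ :=
  Finset.Icc ⌈(m / n : ℝ) - (ρ + 9)⌉ ⌊(m / n : ℝ) + (ρ + 9)⌋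

/-- The packets of `u` that are near the `j`-th spatial interval of length `n`. -/
def near (n : ℕ) (ρ : ℝ) (u : Finset (Index R)) (j : ℤ) : Finset (Index R) :=
  {q ∈ u | j ∈ nearIndices n ρ q.2}

/-- The indices of the intervals of length `n` that contain a frequency index of `s`. -/
def cellIndices (n : ℕ) (s : Finset (Index R)) : Finset ℤ :=
  s.image fun q => (q.1 : ℤ) / (n : ℤ)

theorem near_subset (n : ℕ) (ρ : ℝ) (u : Finset (Index R)) (j : ℤ) : near n ρ u j ⊆ u :=
  Finset.filter_subset _ _

theorem cell_subset (n : ℕ) (s : Finset (Index R)) (i : ℤ) : cell n s i ⊆ s :=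
  Finset.filter_subset _ _

theorem mem_Ico_of_mem_cell (hn : 0 < n) {i : ℤ} {q : Index R} (hq : q ∈ cell n s i) :
    (q.1 : ℤ) ∈ Finset.Ico (n * i) (n * i + n) := by
  have hn' : (0 : ℤ) < n := by exact_mod_cast hn
  have hdiv := Int.emod_add_mul_ediv q.1 n
  rw [(Finset.mem_filter.1 hq).2] at hdiv
  rw [Finset.mem_Ico]
  constructor <;> linarith [Int.emod_nonneg q.1 hn'.ne', Int.emod_lt_of_pos q.1 hn']

theorem abs_sub_le_of_mem_cell (hn : 0 < n) {i i' : ℤ} (hi : |i - i'| ≤ 3) {q : Index R}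
    (hq : q ∈ cell n s i') : |((q.1 : ℤ) : ℝ) - n * i| ≤ 4 * n := by
  obtain ⟨hlo, hhi⟩ := Finset.mem_Ico.1 (mem_Ico_of_mem_cell hn hq)
  obtain ⟨hi1, hi2⟩ := abs_le.1 hi
  have hle : (n : ℤ) * i ≤ n * (i' + 3) := by gcongr; linarith
  have hge : (n : ℤ) * (i' - 3) ≤ n * i := by gcongr; linarith
  have : |(q.1 : ℤ) - n * i| ≤ 4 * n := by
    rw [abs_le]
    constructor <;> linarith
  exact_mod_cast this

theorem mem_nearIndices {j m : ℤ} : j ∈ nearIndices n ρ m ↔ |(j : ℝ) - m / n| ≤ ρ + 9 := by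
  rw [nearIndices, Finset.mem_Icc, Int.ceil_le, Int.le_floor, abs_le, neg_le_sub_iff_le_add,
    sub_le_iff_le_add, sub_le_iff_le_add, add_comm (ρ + 9)]

theorem card_Icc_ceil_floor_le {a b : ℝ} (h : a ≤ b + 1) :
    ((Finset.Icc ⌈a⌉ ⌊b⌋).card : ℝ) ≤ b - a + 1 := by
  rw [Int.card_Icc, ← Int.cast_natCast, Int.toNat_eq_max]
  push_cast
  exact max_le (by linarith [Int.floor_le b, Int.le_ceil a]) (by linarith)

theorem card_nearIndices_le (n : ℕ) (hρ : 1 ≤ ρ) (m : ℤ) :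
    ((nearIndices n ρ m).card : ℝ) ≤ 21 * ρ :=
  (card_Icc_ceil_floor_le (by linarith)).trans (by linarith)

theorem le_one_add_abs_of_notMem_nearIndices (hn : 0 < n) (hρ : 0 ≤ ρ) {i : ℤ} {q : Index R}
    (hq : |((q.1 : ℤ) : ℝ) - n * i| ≤ 4 * n) {X T : ℝ} (hT : |T| ≤ 1)
    (h : ⌊(X + 2 * (n * i) * T) / n⌋ ∉ nearIndices n ρ q.2) :
    ρ ≤ 1 + |X - q.2 + 2 * (q.1 : ℤ) * T| := by
  have hn1 : (1 : ℝ) ≤ n := by exact_mod_cast hn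
  have hn0 : (0 : ℝ) < n := by linarith
  set Y := (X + 2 * (n * i) * T) / n with hY
  have hsplit : n * (Y - q.2 / n) =
      (X - q.2 + 2 * (q.1 : ℤ) * T) - 2 * (((q.1 : ℤ) - n * i) * T) := by
    rw [hY]
    field_simp
    ring
  have hdrift : |((q.1 : ℤ) - n * i) * T| ≤ 4 * n := by
    rw [abs_mul]
    exact (mul_le_mul hq hT (abs_nonneg _) (by positivity)).trans_eq (mul_one _)
  have hmain : n * |Y - q.2 / n| ≤ |X - q.2 + 2 * (q.1 : ℤ) * T| + 8 * n := by
    rw [← abs_of_pos hn0, ← abs_mul, abs_of_pos hn0, hsplit]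
    refine (abs_sub _ _).trans ?_
    rw [abs_mul 2, abs_two]
    linarith
  have hround : |(⌊Y⌋ : ℝ) - q.2 / n| ≤ |Y - q.2 / n| + 1 := by
    have := abs_sub_le (⌊Y⌋ : ℝ) Y (q.2 / n)
    have hfloor : |(⌊Y⌋ : ℝ) - Y| ≤ 1 := by
      rw [abs_sub_comm, abs_of_nonneg (sub_nonneg.2 (Int.floor_le Y))]
      linarith [Int.lt_floor_add_one Y]
    linarith
  rw [mem_nearIndices, not_le] at h
  have : n * (ρ + 8) ≤ n * |Y - q.2 / n| := by gcongr; linarith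
  nlinarith

theorem card_near_cell_le (hn : 0 < n) (hρ : 1 ≤ ρ) (s : Finset (Index R)) (i j : ℤ) :
    ((near n ρ (cell n s i) j).card : ℝ) ≤ 21 * ρ * n ^ 2 := by
  have hn1 : (1 : ℝ) ≤ n := by exact_mod_cast hn
  have hnρ : (n : ℝ) ≤ ρ * n := le_mul_of_one_le_left (by positivity) hρ
  set a : ℝ := n * j - (ρ + 9) * n
  set b : ℝ := n * j + (ρ + 9) * n
  have hmaps : ∀ q ∈ near n ρ (cell n s i) j,
      ((q.1 : ℤ), q.2) ∈ Finset.Ico ((n : ℤ) * i) (n * i + n) ×ˢ Finset.Icc ⌈a⌉ ⌊b⌋ := by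
    intro q hq
    have hj := (Finset.mem_filter.1 hq).2
    have hq2 : (q.2 : ℝ) / n * n = q.2 := by field_simp
    rw [mem_nearIndices, abs_le] at hj
    rw [Finset.mem_product, Finset.mem_Icc, Int.ceil_le, Int.le_floor]
    refine ⟨mem_Ico_of_mem_cell hn (near_subset _ _ _ _ hq), ?_, ?_⟩ <;>
      simp only [a, b] <;> nlinarith
  have hinj : Function.Injective fun q : Index R => ((q.1 : ℤ), q.2) :=
    Subtype.val_injective.prodMap Function.injective_id
  have hcard := Finset.card_le_card_of_injOn _ hmaps hinj.injOn
  rw [Finset.card_product, Int.card_Ico, add_sub_cancel_left, Int.toNat_natCast] at hcard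
  calc ((near n ρ (cell n s i) j).card : ℝ) ≤ n * (Finset.Icc ⌈a⌉ ⌊b⌋).card := by
        exact_mod_cast hcard
    _ ≤ n * (b - a + 1) := by
        gcongr
        exact card_Icc_ceil_floor_le (by simp only [a, b]; linarith)
    _ ≤ n * (21 * ρ * n) := by
        gcongr
        simp only [a, b]
        linarith
    _ = _ := by ring

/-- The coefficients of the packets of `s` are bounded by `b` in `ℓ^∞` and by `H` in `ℓ²`. The
normalisation `b ≤ H` is free, since the `ℓ²` norm dominates the `ℓ^∞` norm. -/
structure IsCoeffBound (c : Index R → ℂ) (s : Finset (Index R)) (b H : ℝ) : Prop where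
  nonneg : 0 ≤ b
  le : b ≤ H
  norm_le : ∀ q ∈ s, ‖c q‖ ≤ b
  sum_sq_le : ∑ q ∈ s, ‖c q‖ ^ 2 ≤ H ^ 2

theorem IsCoeffBound.nonneg_right (h : IsCoeffBound c s b H) : 0 ≤ H :=
  h.nonneg.trans h.le

theorem sum_near_cell_sq_le (hn : 0 < n) (hρ : 1 ≤ ρ) (i j : ℤ) (hc : IsCoeffBound c s b H) :
    ∑ q ∈ near n ρ (cell n s i) j, ‖c q‖ ^ 2 ≤ 21 * ρ * n * (b * H) := by
  have hsub : near n ρ (cell n s i) j ⊆ s := (near_subset _ _ _ _).trans (cell_subset _ _ _)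
  set S := ∑ q ∈ near n ρ (cell n s i) j, ‖c q‖ ^ 2
  have hSH : S ≤ H ^ 2 :=
    (Finset.sum_le_sum_of_subset_of_nonneg hsub fun _ _ _ => sq_nonneg _).trans hc.sum_sq_le
  have hSb : S ≤ 21 * ρ * n ^ 2 * b ^ 2 :=
    calc S ≤ ∑ _q ∈ near n ρ (cell n s i) j, b ^ 2 :=
          Finset.sum_le_sum fun q hq => pow_le_pow_left₀ (norm_nonneg _) (hc.norm_le q (hsub hq)) 2
      _ = (near n ρ (cell n s i) j).card * b ^ 2 := by rw [Finset.sum_const, nsmul_eq_mul]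
      _ ≤ _ := by gcongr; exact card_near_cell_le hn hρ s i j
  have hb := hc.nonneg
  have hH := hc.nonneg_right
  refine le_of_sq_le_sq ?_ (by positivity)
  calc S ^ 2 = S * S := sq S
    _ ≤ (21 * ρ * n ^ 2 * b ^ 2) * H ^ 2 := by gcongr
    _ = (21 * ρ) * (n ^ 2 * b ^ 2 * H ^ 2) := by ring
    _ ≤ (21 * ρ) ^ 2 * (n ^ 2 * b ^ 2 * H ^ 2) := by
        gcongr
        exact le_self_pow₀ (by linarith) two_ne_zero
    _ = _ := by ring

theorem sum_sum_near_sq_le (n : ℕ) (hρ : 1 ≤ ρ) (u : Finset (Index R)) (J : Finset ℤ)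
    (c : Index R → ℂ) :
    ∑ j ∈ J, ∑ q ∈ near n ρ u j, ‖c q‖ ^ 2 ≤ 21 * ρ * ∑ q ∈ u, ‖c q‖ ^ 2 := by
  simp_rw [near, Finset.sum_filter]
  rw [Finset.sum_comm, Finset.mul_sum]
  refine Finset.sum_le_sum fun q _ => ?_
  rw [← Finset.sum_filter, Finset.sum_const, nsmul_eq_mul]
  gcongr
  refine le_trans ?_ (card_nearIndices_le n hρ q.2)
  exact_mod_cast Finset.card_le_card fun j hj => (Finset.mem_filter.1 hj).2

end Cells

variable {i i' : ℤ}

section Strip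

/-- Lebesgue measure on the strip of all `(x, t)` with `|t| ≤ R`, where the packets decay. -/
def strip (R : ℝ) : Measure (ℝ × ℝ) := (volume : Measure ℝ).prod (volume.restrict (Icc (-R) R))

theorem lintegral_strip (R : ℝ) {G : ℝ × ℝ → ℝ≥0∞} (hG : Measurable G) :
    ∫⁻ z, G z ∂strip R = ∫⁻ t in Icc (-R) R, ∫⁻ x, G (x, t) :=
  lintegral_prod_symm' _ hG

theorem ae_strip_abs_le (R : ℝ) : ∀ᵐ z ∂strip R, |z.2| ≤ R :=
  Measure.quasiMeasurePreserving_snd.ae (p := fun t : ℝ => |t| ≤ R) <|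
    (ae_restrict_mem measurableSet_Icc).mono fun _ ht => abs_le.2 ht

theorem volume_restrict_Icc_neg_univ (R : ℝ) :
    (volume.restrict (Icc (-R) R)) univ = ENNReal.ofReal (2 * R) := by
  rw [Measure.restrict_apply_univ, Real.volume_Icc, sub_neg_eq_add, two_mul]

theorem enorm_sq_eq_ofReal (w : ℂ) : ‖w‖ₑ ^ 2 = ENNReal.ofReal (‖w‖ ^ 2) := by
  rw [← ofReal_norm, ENNReal.ofReal_pow (norm_nonneg _)]

theorem norm_mul_sq_le_of_norm_sub_le {F F' G G' : ℂ} {a e : ℝ} (hF' : ‖F'‖ ≤ a) (hG : ‖G‖ ≤ a)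
    (h : ‖F - G‖ ≤ e) (h' : ‖F' - G'‖ ≤ e) :
    ‖F * F'‖ ^ 2 ≤ 2 * ‖G * G'‖ ^ 2 + 8 * (a * e) ^ 2 := by
  have ha : 0 ≤ a := (norm_nonneg _).trans hG
  have hmul : ‖F * F'‖ ≤ ‖G * G'‖ + 2 * (a * e) :=
    calc ‖F * F'‖ = ‖G * G' + ((F - G) * F' + G * (F' - G'))‖ := by ring_nf
      _ ≤ ‖G * G'‖ + (‖F - G‖ * ‖F'‖ + ‖G‖ * ‖F' - G'‖) := by
          rw [← norm_mul (F - G), ← norm_mul G (F' - G')]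
          exact (norm_add_le _ _).trans (add_le_add_right (norm_add_le _ _) _)
      _ ≤ ‖G * G'‖ + (e * a + a * e) := by gcongr; exact (norm_nonneg _).trans h
      _ = _ := by ring
  calc ‖F * F'‖ ^ 2 ≤ (‖G * G'‖ + 2 * (a * e)) ^ 2 := by gcongr
    _ ≤ 2 * (‖G * G'‖ ^ 2 + (2 * (a * e)) ^ 2) := add_sq_le
    _ = _ := by ring

end Strip

section Pairs

/-- A bound for the error, at `z`, of replacing a pair of cells by their near parts. -/
def pairError (R : ℝ) (K : ℕ → ℝ) (c : Index R → ℂ) (s : Finset (Index R)) (N : ℕ) (ρ : ℝ)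
    (z : ℝ × ℝ) : ℝ :=
  8 * (K 2 ^ 2 * K (N + 2) ^ 2 * R⁻¹ * ((ρ ^ N)⁻¹) ^ 2) * majorant c s (z.1 / √R) (z.2 / R) ^ 4

/-- The constant in the bilinear estimate for the near parts of a pair of separated cells. -/
def nearConst (K : ℕ → ℝ) : ℝ := 12 * 21 ^ 2 * Real.pi ^ 2 * besselConst K ^ 2

namespace IsPacketFamily

variable (hφ : IsPacketFamily R K φ)

include hφ

theorem measurable_enorm_wave_mul_sq (c : Index R → ℂ) (u v : Finset (Index R)) :
    Measurable fun z => ‖wave c φ u z * wave c φ v z‖ₑ ^ 2 :=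
  ((hφ.continuous_wave c u).mul (hφ.continuous_wave c v)).measurable.enorm.pow_const 2

theorem mem_Icc_of_packetSum_cell_ne_zero (hn : 0 < n) {u : Finset (Index R)}
    (hu : u ⊆ cell n s i) {ω : ℝ} (hω : packetSum c φ u ω ≠ 0) :
    ω * √R ∈ Icc (n * i - 3 : ℝ) (n * i + n + 2) := by
  obtain ⟨q, hq, hqne⟩ := Finset.exists_ne_zero_of_sum_ne_zero hω
  have hsupp := abs_le.1 (hφ.support q ω (right_ne_zero_of_mul hqne))
  obtain ⟨hlo, hhi⟩ := Finset.mem_Ico.1 (mem_Ico_of_mem_cell hn (hu hq))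
  have hlo' : (n * i : ℝ) ≤ (q.1 : ℤ) := by exact_mod_cast hlo
  have hhi' : ((q.1 : ℤ) : ℝ) + 1 ≤ n * i + n := by exact_mod_cast hhi
  constructor <;> linarith

theorem add_le_of_packetSum_cell_ne_zero (hn : 8 ≤ n) {u v : Finset (Index R)}
    (hu : u ⊆ cell n s i) (hv : v ⊆ cell n s i') (hi : i' + 2 ≤ i) {ω η : ℝ}
    (hω : packetSum c φ u ω ≠ 0) (hη : packetSum c φ v η ≠ 0) : η + n / (3 * √R) ≤ ω := by
  have hr : 0 < √R := Real.sqrt_pos.2 hφ.radius_pos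
  have hlo := (hφ.mem_Icc_of_packetSum_cell_ne_zero (by lia) hu hω).1
  have hhi := (hφ.mem_Icc_of_packetSum_cell_ne_zero (by lia) hv hη).2
  have hn8 : (8 : ℝ) ≤ n := by exact_mod_cast hn
  have hsep : (n * (i' + 2) : ℝ) ≤ n * i := by
    gcongr
    exact_mod_cast hi
  refine le_of_mul_le_mul_right ?_ hr
  calc (η + n / (3 * √R)) * √R = η * √R + n / 3 := by field_simp
    _ ≤ ω * √R := by linarith

theorem lintegral_bilinear_cells_le (c : Index R → ℂ) (hn : 8 ≤ n) {u v : Finset (Index R)}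
    (hu : u ⊆ cell n s i) (hv : v ⊆ cell n s i') (hi : 2 ≤ |i - i'|) :
    ∫⁻ z, ‖wave c φ u z * wave c φ v z‖ₑ ^ 2 ∂strip R ≤
      ENNReal.ofReal (6 * Real.pi ^ 2 * besselConst K ^ 2 * (√R / n) *
        ((∑ q ∈ u, ‖c q‖ ^ 2) * ∑ q ∈ v, ‖c q‖ ^ 2)) := by
  wlog h : i' + 2 ≤ i generalizing u v i i'
  · have h' : i + 2 ≤ i' := by
      rcases le_abs.1 hi with _ | _ <;> linarith
    simpa only [mul_comm] using this hv hu (abs_sub_comm i i' ▸ hi) h'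
  have hr : 0 < √R := Real.sqrt_pos.2 hφ.radius_pos
  have : (0 : ℝ) < n := by exact_mod_cast (by lia : 0 < n)
  have hB := besselConst_nonneg K
  rw [lintegral_strip R (hφ.measurable_enorm_wave_mul_sq c u v)]
  calc _ ≤ ENNReal.ofReal (2 * Real.pi ^ 2 / (n / (3 * √R))) *
        ((∫⁻ ω, ‖packetSum c φ u ω‖ₑ ^ 2) * ∫⁻ ω, ‖packetSum c φ v ω‖ₑ ^ 2) :=
        (setLIntegral_le_lintegral _ _).trans <|
          lintegral_bilinear_le (hφ.integrable_packetSum c u) (hφ.memLp_packetSum c u)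
            (hφ.integrable_packetSum c v) (hφ.memLp_packetSum c v) (by positivity)
            fun _ _ => hφ.add_le_of_packetSum_cell_ne_zero hn hu hv h
    _ ≤ ENNReal.ofReal (2 * Real.pi ^ 2 / (n / (3 * √R))) *
        (ENNReal.ofReal (besselConst K * ∑ q ∈ u, ‖c q‖ ^ 2) *
        ENNReal.ofReal (besselConst K * ∑ q ∈ v, ‖c q‖ ^ 2)) := by
        gcongr <;> exact hφ.lintegral_packetSum_sq_le c _
    _ = _ := by
        rw [← ENNReal.ofReal_mul (by positivity), ← ENNReal.ofReal_mul (by positivity)]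
        congr 1
        field_simp
        ring

theorem norm_wave_cell_sub_wave_near_le (c : Index R → ℂ) (s : Finset (Index R)) (hn : 0 < n)
    (hi : |i - i'| ≤ 3) (hρ : 1 ≤ ρ) (N : ℕ) {z : ℝ × ℝ} (hz : |z.2| ≤ R) :
    ‖wave c φ (cell n s i') z -
      wave c φ (near n ρ (cell n s i') ⌊(z.1 / √R + 2 * (n * i) * (z.2 / R)) / n⌋) z‖ ≤
    K (N + 2) * R ^ (-(1 / 4) : ℝ) * (ρ ^ N)⁻¹ * majorant c s (z.1 / √R) (z.2 / R) := by
  set j := ⌊(z.1 / √R + 2 * (n * i) * (z.2 / R)) / n⌋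
  have hR := hφ.radius_pos
  have hK := hφ.nonneg_const (N := N + 2) (by lia)
  have hT : |z.2 / R| ≤ 1 := by
    rwa [abs_div, abs_of_pos hR, div_le_one hR]
  have hsplit : wave c φ (cell n s i') z - wave c φ (near n ρ (cell n s i') j) z =
      wave c φ {q ∈ cell n s i' | j ∉ nearIndices n ρ q.2} z := by
    rw [hφ.wave_eq_sum, hφ.wave_eq_sum, hφ.wave_eq_sum, sub_eq_iff_eq_add', near]
    exact (Finset.sum_filter_add_sum_filter_not (cell n s i') _ _).symm
  rw [hsplit]
  refine (hφ.norm_wave_le_of_far c hz N (ρ := ρ) (by linarith) fun q hq => ?_).trans ?_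
  · obtain ⟨hqcell, hqfar⟩ := Finset.mem_filter.1 hq
    exact le_one_add_abs_of_notMem_nearIndices hn (by linarith)
      (abs_sub_le_of_mem_cell hn hi hqcell) hT hqfar
  · gcongr
    exact majorant_mono c ((Finset.filter_subset _ _).trans (cell_subset _ _ _)) _ _

theorem norm_wave_le_of_subset (c : Index R → ℂ) {u : Finset (Index R)} (hu : u ⊆ s)
    {z : ℝ × ℝ} (hz : |z.2| ≤ R) :
    ‖wave c φ u z‖ ≤ K 2 * R ^ (-(1 / 4) : ℝ) * majorant c s (z.1 / √R) (z.2 / R) := by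
  have hK := hφ.nonneg_const (N := 2) two_pos
  have hR := hφ.radius_pos
  refine (hφ.norm_wave_le c u hz).trans ?_
  gcongr
  exact majorant_mono c hu _ _

theorem exists_norm_wave_mul_sq_le_near (c : Index R → ℂ) (s : Finset (Index R)) (hn : 0 < n)
    (hi : |i - i'| ≤ 3) (hρ : 1 ≤ ρ) (N : ℕ) {z : ℝ × ℝ} (hz : |z.2| ≤ R) :
    ∃ j : ℤ, ‖wave c φ (cell n s i) z * wave c φ (cell n s i') z‖ ^ 2 ≤
      2 * ‖wave c φ (near n ρ (cell n s i) j) z * wave c φ (near n ρ (cell n s i') j) z‖ ^ 2 +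
      pairError R K c s N ρ z := by
  have hpow : (R ^ (-(1 / 4) : ℝ)) ^ 4 = R⁻¹ := by
    rw [pow_mul _ 2 2, rpow_neg_quarter_sq hφ.radius_pos, inv_pow, Real.sq_sqrt hφ.radius_pos.le]
  refine ⟨⌊(z.1 / √R + 2 * (n * i) * (z.2 / R)) / n⌋, (norm_mul_sq_le_of_norm_sub_le
    (hφ.norm_wave_le_of_subset c (cell_subset n s i') hz)
    (hφ.norm_wave_le_of_subset c ((near_subset n ρ _ _).trans (cell_subset n s i)) hz)
    (hφ.norm_wave_cell_sub_wave_near_le c s hn (i := i) (by simp) hρ N hz)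
    (hφ.norm_wave_cell_sub_wave_near_le c s hn hi hρ N hz)).trans_eq ?_⟩
  rw [pairError, ← hpow]
  ring

theorem enorm_wave_mul_sq_le_sum_near (c : Index R → ℂ) (s : Finset (Index R)) (hn : 0 < n)
    (hi : |i - i'| ≤ 3) (hρ : 1 ≤ ρ) (N : ℕ) {z : ℝ × ℝ} (hz : |z.2| ≤ R) :
    ‖wave c φ (cell n s i) z * wave c φ (cell n s i') z‖ₑ ^ 2 ≤
      2 * ∑ j ∈ s.biUnion fun q => nearIndices n ρ q.2,
        ‖wave c φ (near n ρ (cell n s i) j) z * wave c φ (near n ρ (cell n s i') j) z‖ₑ ^ 2 +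
      ENNReal.ofReal (pairError R K c s N ρ z) := by
  obtain ⟨j, hj⟩ := hφ.exists_norm_wave_mul_sq_le_near c s hn hi hρ N hz
  have hR := hφ.radius_pos
  replace hj := ENNReal.ofReal_le_ofReal hj
  rw [ENNReal.ofReal_add (by positivity) (by unfold pairError; positivity),
    ENNReal.ofReal_mul zero_le_two, ← enorm_sq_eq_ofReal, ← enorm_sq_eq_ofReal,
    ENNReal.ofReal_ofNat] at hj
  refine hj.trans ?_
  gcongr
  by_cases hjs : j ∈ s.biUnion fun q => nearIndices n ρ q.2
  · exact Finset.single_le_sum (f := fun j => ‖wave c φ (near n ρ (cell n s i) j) z *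
      wave c φ (near n ρ (cell n s i') j) z‖ₑ ^ 2) (fun _ _ => zero_le) hjs
  · have hempty : near n ρ (cell n s i) j = ∅ := Finset.filter_eq_empty_iff.2 fun q hq hjq =>
      hjs (Finset.mem_biUnion.2 ⟨q, cell_subset n s i hq, hjq⟩)
    rw [hempty, hφ.wave_eq_sum]
    simp

theorem sum_lintegral_near_pair_le (hn : 8 ≤ n) (hi : 2 ≤ |i - i'|) (hρ : 1 ≤ ρ)
    (hc : IsCoeffBound c s b H) (J : Finset ℤ) :
    2 * ∑ j ∈ J, ∫⁻ z, ‖wave c φ (near n ρ (cell n s i) j) z *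
        wave c φ (near n ρ (cell n s i') j) z‖ₑ ^ 2 ∂strip R ≤
      ENNReal.ofReal (nearConst K * ρ ^ 2 * √R * (b * H) * ∑ q ∈ cell n s i, ‖c q‖ ^ 2) := by
  have : (0 : ℝ) < n := by exact_mod_cast (by lia : 0 < n)
  have hb := hc.nonneg
  have hH := hc.nonneg_right
  set D := 6 * Real.pi ^ 2 * besselConst K ^ 2 * (√R / n) with hD
  calc _ ≤ 2 * ∑ j ∈ J, ENNReal.ofReal (D *
        ((∑ q ∈ near n ρ (cell n s i) j, ‖c q‖ ^ 2) * (21 * ρ * n * (b * H)))) := by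
        gcongr with j
        refine (hφ.lintegral_bilinear_cells_le c hn (near_subset n ρ (cell n s i) j)
          (near_subset n ρ (cell n s i') j) hi).trans (ENNReal.ofReal_le_ofReal ?_)
        rw [← hD]
        gcongr
        exact sum_near_cell_sq_le (by lia) hρ i' j hc
    _ = ENNReal.ofReal (2 * (D * ((∑ j ∈ J, ∑ q ∈ near n ρ (cell n s i) j, ‖c q‖ ^ 2) *
          (21 * ρ * n * (b * H))))) := by
        rw [Finset.sum_mul, Finset.mul_sum J _ D, ENNReal.ofReal_mul zero_le_two,
          ENNReal.ofReal_ofNat, ENNReal.ofReal_sum_of_nonneg fun j _ => by positivity]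
    _ ≤ ENNReal.ofReal (2 * (D * ((21 * ρ * ∑ q ∈ cell n s i, ‖c q‖ ^ 2) *
          (21 * ρ * n * (b * H))))) := by
        gcongr
        exact sum_sum_near_sq_le n hρ _ J c
    _ = _ := by
        rw [hD, nearConst]
        congr 1
        field_simp
        ring

theorem lintegral_pair_le (hn : 8 ≤ n) (hi : 2 ≤ |i - i'|) (hi' : |i - i'| ≤ 3) (hρ : 1 ≤ ρ)
    (N : ℕ) (hc : IsCoeffBound c s b H) :
    ∫⁻ z, ‖wave c φ (cell n s i) z * wave c φ (cell n s i') z‖ₑ ^ 2 ∂strip R ≤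
      ENNReal.ofReal (nearConst K * ρ ^ 2 * √R * (b * H) * ∑ q ∈ cell n s i, ‖c q‖ ^ 2) +
      ∫⁻ z, ENNReal.ofReal (pairError R K c s N ρ z) ∂strip R := by
  have hmeas (j : ℤ) := hφ.measurable_enorm_wave_mul_sq c (near n ρ (cell n s i) j)
    (near n ρ (cell n s i') j)
  refine (lintegral_mono_ae ((ae_strip_abs_le R).mono fun z hz =>
    hφ.enorm_wave_mul_sq_le_sum_near c s (n := n) (by lia) hi' hρ N hz)).trans ?_
  rw [lintegral_add_left ((Finset.measurable_sum _ fun j _ => hmeas j).const_mul 2),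
    lintegral_const_mul' _ _ ENNReal.ofNat_ne_top, lintegral_finsetSum _ fun j _ => hmeas j]
  gcongr
  exact hφ.sum_lintegral_near_pair_le hn hi hρ hc _

end IsPacketFamily

end Pairs

section SumPairs

theorem sum_fst_le_of_abs_sub_le {I : Finset ℤ} {P : Finset (ℤ × ℤ)} (hI : ∀ p ∈ P, p.1 ∈ I)
    (hP : ∀ p ∈ P, |p.1 - p.2| ≤ 3) {g : ℤ → ℝ} (hg : ∀ i, 0 ≤ g i) :
    ∑ p ∈ P, g p.1 ≤ 7 * ∑ i ∈ I, g i := by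
  rw [← Finset.sum_fiberwise_of_maps_to hI, Finset.mul_sum]
  refine Finset.sum_le_sum fun i _ => ?_
  have hcard : {p ∈ P | p.1 = i}.card ≤ (Finset.Icc (i - 3) (i + 3)).card := by
    refine Finset.card_le_card_of_injOn Prod.snd (fun p hp => ?_) fun p hp p' hp' h => ?_
    · obtain ⟨hpP, rfl⟩ := Finset.mem_filter.1 (Finset.mem_coe.1 hp)
      have := abs_le.1 (hP p hpP)
      rw [Finset.mem_coe, Finset.mem_Icc]
      constructor <;> linarith
    · exact Prod.ext (((Finset.mem_filter.1 hp).2).trans (Finset.mem_filter.1 hp').2.symm) h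
  rw [Int.card_Icc, show i + 3 + 1 - (i - 3) = 7 by ring] at hcard
  calc ∑ p ∈ P with p.1 = i, g p.1 = ∑ p ∈ P with p.1 = i, g i :=
        Finset.sum_congr rfl fun p hp => by rw [(Finset.mem_filter.1 hp).2]
    _ = {p ∈ P | p.1 = i}.card * g i := by rw [Finset.sum_const, nsmul_eq_mul]
    _ ≤ 7 * g i := mul_le_mul_of_nonneg_right (by exact_mod_cast hcard) (hg i)

theorem abs_freqIndex_le (hR : 0 < R) (q : Index R) : |((q.1 : ℤ) : ℝ)| ≤ √R := by
  obtain ⟨⟨k, hk⟩, -⟩ := q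
  rwa [mem_Icc, ← abs_le, Real.rpow_neg hR.le, ← Real.sqrt_eq_rpow, ← div_eq_mul_inv, abs_div,
    abs_of_nonneg R.sqrt_nonneg, div_le_one (Real.sqrt_pos.2 hR)] at hk

theorem freqIndex_mem_Icc (hR : 0 < R) (q : Index R) :
    (q.1 : ℤ) ∈ Finset.Icc ⌈-√R⌉ ⌊√R⌋ := by
  rw [Finset.mem_Icc, Int.ceil_le, Int.le_floor]
  exact abs_le.1 (abs_freqIndex_le hR q)

theorem card_Icc_sqrt_le (hR : 1 ≤ R) : ((Finset.Icc ⌈-√R⌉ ⌊√R⌋).card : ℝ) ≤ 3 * √R := by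
  have hr : 1 ≤ √R := Real.one_le_sqrt.2 hR
  linarith [card_Icc_ceil_floor_le (a := -√R) (b := √R) (by linarith)]

theorem card_cellIndices_le (hR : 1 ≤ R) (n : ℕ) (s : Finset (Index R)) :
    ((cellIndices n s).card : ℝ) ≤ 3 * R := by
  have hsub : cellIndices n s ⊆ (Finset.Icc ⌈-√R⌉ ⌊√R⌋).image (· / (n : ℤ)) := by
    intro i hi
    obtain ⟨q, -, rfl⟩ := Finset.mem_image.1 hi
    exact Finset.mem_image_of_mem _ (freqIndex_mem_Icc (by linarith) q)
  calc ((cellIndices n s).card : ℝ) ≤ (Finset.Icc ⌈-√R⌉ ⌊√R⌋).card := by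
        exact_mod_cast (Finset.card_le_card hsub).trans Finset.card_image_le
    _ ≤ 3 * √R := card_Icc_sqrt_le hR
    _ ≤ 3 * R := by
        gcongr
        exact Real.sqrt_le_self_iff.2 (Or.inr hR)

theorem sum_sum_cell (n : ℕ) (s : Finset (Index R)) (g : Index R → ℝ) :
    ∑ i ∈ cellIndices n s, ∑ q ∈ cell n s i, g q = ∑ q ∈ s, g q :=
  Finset.sum_fiberwise_of_maps_to (fun _ hq => Finset.mem_image_of_mem _ hq) _

theorem measurable_majorant_sq (c : Index R → ℂ) (s : Finset (Index R)) :
    Measurable fun z : ℝ × ℝ => ENNReal.ofReal (majorant c s (z.1 / √R) (z.2 / R) ^ 2) :=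
  ((continuous_majorant c s (by fun_prop) (by fun_prop)).measurable.pow_const 2).ennreal_ofReal

theorem lintegral_strip_majorant_sq_le (hR : 1 ≤ R) (c : Index R → ℂ) (s : Finset (Index R)) :
    ∫⁻ z, ENNReal.ofReal (majorant c s (z.1 / √R) (z.2 / R) ^ 2) ∂strip R ≤
      ENNReal.ofReal (6 * Real.pi * wtSum * R ^ 2 * ∑ q ∈ s, ‖c q‖ ^ 2) := by
  have hR0 : 0 < R := by linarith
  have hr : 0 < √R := Real.sqrt_pos.2 hR0
  have hW := wtSum_nonneg
  have hslice (T : ℝ) : ∫⁻ x, ENNReal.ofReal (majorant c s (x / √R) T ^ 2) ≤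
      ENNReal.ofReal (3 * √R * wtSum * (Real.pi * √R) * ∑ q ∈ s, ‖c q‖ ^ 2) := by
    refine (lintegral_majorant_sq_le c (fun q _ => freqIndex_mem_Icc hR0 q) hr T).trans
      (ENNReal.ofReal_le_ofReal ?_)
    gcongr
    exact card_Icc_sqrt_le hR
  rw [lintegral_strip R (measurable_majorant_sq c s)]
  calc _ ≤ ∫⁻ _ in Icc (-R) R,
        ENNReal.ofReal (3 * √R * wtSum * (Real.pi * √R) * ∑ q ∈ s, ‖c q‖ ^ 2) :=
        lintegral_mono fun t => hslice (t / R)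
    _ = ENNReal.ofReal (3 * √R * wtSum * (Real.pi * √R) * (∑ q ∈ s, ‖c q‖ ^ 2) * (2 * R)) := by
        rw [lintegral_const, volume_restrict_Icc_neg_univ, ← ENNReal.ofReal_mul (by positivity)]
    _ = _ := by
        congr 1
        linear_combination
          6 * Real.pi * wtSum * R * (∑ q ∈ s, ‖c q‖ ^ 2) * Real.sq_sqrt hR0.le

/-- The constant in the bound for the contribution of the packets far from a given point. -/
def farConst (K : ℕ → ℝ) (N : ℕ) : ℝ :=
  432 * Real.pi * K 2 ^ 2 * K (N + 2) ^ 2 * wtSum ^ 3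

theorem farConst_nonneg (K : ℕ → ℝ) (N : ℕ) : 0 ≤ farConst K N := by
  have := wtSum_nonneg
  unfold farConst
  positivity

theorem nearConst_nonneg (K : ℕ → ℝ) : 0 ≤ nearConst K := by
  unfold nearConst
  positivity

theorem pairError_le (hR : 1 ≤ R) (K : ℕ → ℝ) (N : ℕ) (hN : R ^ 3 ≤ (ρ ^ N) ^ 2)
    (hc : IsCoeffBound c s b H) (z : ℝ × ℝ) :
    pairError R K c s N ρ z ≤ 72 * K 2 ^ 2 * K (N + 2) ^ 2 * wtSum ^ 2 * b ^ 2 * (R ^ 3)⁻¹ *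
      majorant c s (z.1 / √R) (z.2 / R) ^ 2 := by
  have hR0 : 0 < R := by linarith
  have hW := wtSum_nonneg
  have hb := hc.nonneg
  set m := majorant c s (z.1 / √R) (z.2 / R)
  have hm0 : 0 ≤ m := majorant_nonneg c s _ _
  have hm : m ≤ b * (3 * √R * wtSum) :=
    (majorant_le (fun q _ => freqIndex_mem_Icc hR0 q) hb hc.norm_le _ _).trans
      (by gcongr; exact card_Icc_sqrt_le hR)
  have hm2 : m ^ 2 ≤ 9 * b ^ 2 * R * wtSum ^ 2 :=
    calc m ^ 2 ≤ (b * (3 * √R * wtSum)) ^ 2 := by gcongr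
      _ = _ := by linear_combination 9 * b ^ 2 * wtSum ^ 2 * Real.sq_sqrt hR0.le
  calc pairError R K c s N ρ z
      = 8 * (K 2 ^ 2 * K (N + 2) ^ 2 * R⁻¹ * ((ρ ^ N) ^ 2)⁻¹) * (m ^ 2 * m ^ 2) := by
        rw [pairError, inv_pow]
        ring
    _ ≤ 8 * (K 2 ^ 2 * K (N + 2) ^ 2 * R⁻¹ * (R ^ 3)⁻¹) *
          (9 * b ^ 2 * R * wtSum ^ 2 * m ^ 2) := by gcongr
    _ = _ := by
        field_simp
        ring

theorem lintegral_pairError_le (hR : 1 ≤ R) (K : ℕ → ℝ) (N : ℕ)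
    (hN : R ^ 3 ≤ (ρ ^ N) ^ 2) (hc : IsCoeffBound c s b H) :
    ∫⁻ z, ENNReal.ofReal (pairError R K c s N ρ z) ∂strip R ≤
      ENNReal.ofReal (farConst K N * R⁻¹ * (b ^ 2 * H ^ 2)) := by
  have : 0 < R := by linarith
  have hW := wtSum_nonneg
  set D := 72 * K 2 ^ 2 * K (N + 2) ^ 2 * wtSum ^ 2 * b ^ 2 * (R ^ 3)⁻¹ with hD
  calc _ ≤ ∫⁻ z, ENNReal.ofReal D *
        ENNReal.ofReal (majorant c s (z.1 / √R) (z.2 / R) ^ 2) ∂strip R := by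
        refine lintegral_mono fun z => ?_
        rw [← ENNReal.ofReal_mul (by positivity)]
        exact ENNReal.ofReal_le_ofReal (pairError_le hR K N hN hc z)
    _ ≤ ENNReal.ofReal D * ENNReal.ofReal (6 * Real.pi * wtSum * R ^ 2 * H ^ 2) := by
        rw [lintegral_const_mul' _ _ ENNReal.ofReal_ne_top]
        gcongr
        refine (lintegral_strip_majorant_sq_le hR c s).trans (ENNReal.ofReal_le_ofReal ?_)
        gcongr
        exact hc.sum_sq_le
    _ = _ := by
        rw [← ENNReal.ofReal_mul (by positivity), hD, farConst]
        congr 1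
        field_simp
        ring

/-- The product of the extensions of a pair of cells. -/
abbrev cellProd (c : Index R → ℂ) (φ : Index R → ℝ → ℂ) (n : ℕ) (s : Finset (Index R))
    (p : ℤ × ℤ) (z : ℝ × ℝ) : ℂ :=
  wave c φ (cell n s p.1) z * wave c φ (cell n s p.2) z

namespace IsPacketFamily

variable (hφ : IsPacketFamily R K φ)

include hφ

theorem continuous_cellProd (c : Index R → ℂ) (n : ℕ) (s : Finset (Index R)) (p : ℤ × ℤ) :
    Continuous (cellProd c φ n s p) :=
  (hφ.continuous_wave c _).mul (hφ.continuous_wave c _)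

theorem lintegral_sum_cellProd_le_sum (c : Index R → ℂ) (s : Finset (Index R)) (hn : 8 ≤ n)
    {P : Finset (ℤ × ℤ)} (hP : ∀ p ∈ P, |p.1 - p.2| ≤ 3) :
    ∫⁻ z, ‖∑ p ∈ P, cellProd c φ n s p z‖ₑ ^ 2 ∂strip R ≤
      28 * ∑ p ∈ P, ∫⁻ z, ‖cellProd c φ n s p z‖ₑ ^ 2 ∂strip R := by
  have hsum : Measurable fun z => ‖∑ p ∈ P, cellProd c φ n s p z‖ₑ ^ 2 :=
    (continuous_finsetSum _ fun p _ =>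
      hφ.continuous_cellProd c n s p).measurable.enorm.pow_const 2
  have hprod (p : ℤ × ℤ) : Measurable fun z => ‖cellProd c φ n s p z‖ₑ ^ 2 :=
    hφ.measurable_enorm_wave_mul_sq c _ _
  rw [lintegral_strip R hsum]
  calc _ ≤ ∫⁻ t in Icc (-R) R, 28 * ∑ p ∈ P, ∫⁻ x, ‖cellProd c φ n s p (x, t)‖ₑ ^ 2 :=
        lintegral_mono fun t => lintegral_sum_neighbours_sq_le
          (g := fun i => packetSum c φ (cell n s i)) (fun i => hφ.integrable_packetSum c _)
          (fun i => hφ.memLp_packetSum c _) hn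
          (fun i ω hω => hφ.mem_Icc_of_packetSum_cell_ne_zero (by lia) Finset.Subset.rfl hω) hP t
    _ = _ := by
        rw [lintegral_const_mul' _ _ ENNReal.ofNat_ne_top,
          lintegral_finsetSum _ fun p _ => (hprod p).lintegral_prod_left']
        simp_rw [lintegral_strip R (hprod _)]

theorem lintegral_sum_cellProd_le (hn : 8 ≤ n) {P : Finset (ℤ × ℤ)}
    (hPs : ∀ p ∈ P, p.1 ∈ cellIndices n s) (hP : ∀ p ∈ P, |p.1 - p.2| ≤ 3) {g : ℤ → ℝ}
    (hg : ∀ i, 0 ≤ g i)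
    (hpair : ∀ p ∈ P, ∫⁻ z, ‖cellProd c φ n s p z‖ₑ ^ 2 ∂strip R ≤ ENNReal.ofReal (g p.1)) :
    ∫⁻ z, ‖∑ p ∈ P, cellProd c φ n s p z‖ₑ ^ 2 ∂strip R ≤
      ENNReal.ofReal (196 * ∑ i ∈ cellIndices n s, g i) :=
  calc _ ≤ 28 * ∑ p ∈ P, ENNReal.ofReal (g p.1) :=
        (hφ.lintegral_sum_cellProd_le_sum c s hn hP).trans (by gcongr with p hp; exact hpair p hp)
    _ = ENNReal.ofReal (28 * ∑ p ∈ P, g p.1) := by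
        rw [ENNReal.ofReal_mul (by norm_num), ENNReal.ofReal_sum_of_nonneg fun _ _ => hg _,
          ENNReal.ofReal_ofNat]
    _ ≤ _ := ENNReal.ofReal_le_ofReal (by linarith [sum_fst_le_of_abs_sub_le hPs hP hg])

theorem lintegral_separated_pairs_le (hR : 1 ≤ R) (hn : 8 ≤ n) {P : Finset (ℤ × ℤ)}
    (hPs : ∀ p ∈ P, p.1 ∈ cellIndices n s) (hP2 : ∀ p ∈ P, 2 ≤ |p.1 - p.2|)
    (hP3 : ∀ p ∈ P, |p.1 - p.2| ≤ 3) {N : ℕ} (hρ : 1 ≤ ρ) (hN : R ^ 3 ≤ (ρ ^ N) ^ 2)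
    (hc : IsCoeffBound c s b H) :
    ∫⁻ z, ‖∑ p ∈ P, cellProd c φ n s p z‖ₑ ^ 2 ∂strip R ≤
      ENNReal.ofReal (196 * (nearConst K + 3 * farConst K N) * (ρ ^ 2 * √R * (b * H ^ 3))) := by
  have : 0 < R := by linarith
  have hb := hc.nonneg
  have hH := hc.nonneg_right
  have hnear := nearConst_nonneg K
  have hfar := farConst_nonneg K N
  refine (hφ.lintegral_sum_cellProd_le hn hPs hP3
    (g := fun i => nearConst K * ρ ^ 2 * √R * (b * H) * (∑ q ∈ cell n s i, ‖c q‖ ^ 2) +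
      farConst K N * R⁻¹ * (b ^ 2 * H ^ 2)) (fun i => by positivity) fun p hp => ?_).trans
    (ENNReal.ofReal_le_ofReal ?_)
  · rw [ENNReal.ofReal_add (by positivity) (by positivity)]
    exact (hφ.lintegral_pair_le hn (hP2 p hp) (hP3 p hp) hρ N hc).trans
      (add_le_add_right (lintegral_pairError_le hR K N hN hc) _)
  rw [Finset.sum_add_distrib, ← Finset.mul_sum, sum_sum_cell, Finset.sum_const, nsmul_eq_mul,
    mul_assoc 196, add_mul]
  have hnear_sum : nearConst K * ρ ^ 2 * √R * (b * H) * ∑ q ∈ s, ‖c q‖ ^ 2 ≤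
      nearConst K * (ρ ^ 2 * √R * (b * H ^ 3)) :=
    calc _ ≤ nearConst K * ρ ^ 2 * √R * (b * H) * H ^ 2 := by
          gcongr
          exact hc.sum_sq_le
      _ = _ := by ring
  have hfar_sum : (cellIndices n s).card * (farConst K N * R⁻¹ * (b ^ 2 * H ^ 2)) ≤
      3 * farConst K N * (ρ ^ 2 * √R * (b * H ^ 3)) :=
    calc _ ≤ 3 * R * (farConst K N * R⁻¹ * (b ^ 2 * H ^ 2)) := by
          gcongr
          exact card_cellIndices_le hR n s
      _ = 3 * farConst K N * (1 * (b * H ^ 2 * b)) := by field_simp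
      _ ≤ 3 * farConst K N * (ρ ^ 2 * √R * (b * H ^ 2 * H)) := by
          gcongr
          · exact one_le_mul_of_one_le_of_one_le (one_le_pow₀ hρ) (Real.one_le_sqrt.2 hR)
          · exact hc.le
      _ = _ := by ring
  exact mul_le_mul_of_nonneg_left (add_le_add hnear_sum hfar_sum) (by norm_num)

theorem norm_wave_cell_le (hn : 0 < n) (hc : IsCoeffBound c s b H) (i : ℤ) {z : ℝ × ℝ}
    (hz : |z.2| ≤ R) :
    ‖wave c φ (cell n s i) z‖ ≤ K 2 * R ^ (-(1 / 4) : ℝ) * (b * (n * wtSum)) := by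
  have hK := hφ.nonneg_const (N := 2) two_pos
  have hR := hφ.radius_pos
  refine (hφ.norm_wave_le c _ hz).trans ?_
  gcongr
  have := majorant_le (c := c) (fun q hq => mem_Ico_of_mem_cell (s := s) (i := i) hn hq) hc.nonneg
    (fun q hq => hc.norm_le q (cell_subset _ _ _ hq)) (z.1 / √R) (z.2 / R)
  rwa [Int.card_Ico, add_sub_cancel_left, Int.toNat_natCast] at this

theorem lintegral_strip_wave_sq_le (c : Index R → ℂ) (u : Finset (Index R)) :
    ∫⁻ z, ‖wave c φ u z‖ₑ ^ 2 ∂strip R ≤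
      ENNReal.ofReal (4 * Real.pi * R * besselConst K * ∑ q ∈ u, ‖c q‖ ^ 2) := by
  have := hφ.radius_pos
  have hB := besselConst_nonneg K
  rw [lintegral_strip R ((hφ.continuous_wave c u).measurable.enorm.pow_const 2)]
  simp_rw [lintegral_extensionOp_sq (hφ.integrable_packetSum c u) (hφ.memLp_packetSum c u)]
  rw [lintegral_const, volume_restrict_Icc_neg_univ]
  calc _ ≤ ENNReal.ofReal (2 * Real.pi) *
        ENNReal.ofReal (besselConst K * ∑ q ∈ u, ‖c q‖ ^ 2) * ENNReal.ofReal (2 * R) := by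
        gcongr
        exact hφ.lintegral_packetSum_sq_le c u
    _ = _ := by
        rw [← ENNReal.ofReal_mul (by positivity), ← ENNReal.ofReal_mul (by positivity)]
        congr 1
        ring

theorem lintegral_cellProd_le (hn : 0 < n) (hc : IsCoeffBound c s b H) (p : ℤ × ℤ) :
    ∫⁻ z, ‖cellProd c φ n s p z‖ₑ ^ 2 ∂strip R ≤
      ENNReal.ofReal (4 * Real.pi * K 2 ^ 2 * besselConst K * (n * wtSum) ^ 2 * √R * b ^ 2 *
        ∑ q ∈ cell n s p.1, ‖c q‖ ^ 2) := by
  have hR := hφ.radius_pos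
  have : 0 < √R := Real.sqrt_pos.2 hR
  set D := K 2 ^ 2 * (√R)⁻¹ * (b * (n * wtSum)) ^ 2 with hD
  have hpt : ∀ᵐ z ∂strip R, ‖cellProd c φ n s p z‖ₑ ^ 2 ≤
      ENNReal.ofReal D * ‖wave c φ (cell n s p.1) z‖ₑ ^ 2 := by
    filter_upwards [ae_strip_abs_le R] with z hz
    rw [cellProd, enorm_mul, mul_pow, mul_comm, enorm_sq_eq_ofReal (wave c φ (cell n s p.2) z),
      hD, ← rpow_neg_quarter_sq hR, ← mul_pow, ← mul_pow]
    gcongr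
    exact hφ.norm_wave_cell_le hn hc p.2 hz
  calc _ ≤ ENNReal.ofReal D * ENNReal.ofReal
        (4 * Real.pi * R * besselConst K * ∑ q ∈ cell n s p.1, ‖c q‖ ^ 2) := by
        refine (lintegral_mono_ae hpt).trans ?_
        rw [lintegral_const_mul' _ _ ENNReal.ofReal_ne_top]
        gcongr
        exact hφ.lintegral_strip_wave_sq_le c _
    _ = _ := by
        rw [← ENNReal.ofReal_mul (by positivity), hD]
        congr 1
        nth_rewrite 2 [← Real.sq_sqrt hR.le]
        field_simp

theorem lintegral_diagonal_pairs_le (hn : 8 ≤ n) {P : Finset (ℤ × ℤ)}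
    (hPs : ∀ p ∈ P, p.1 ∈ cellIndices n s) (hP : ∀ p ∈ P, |p.1 - p.2| ≤ 3)
    (hc : IsCoeffBound c s b H) :
    ∫⁻ z, ‖∑ p ∈ P, cellProd c φ n s p z‖ₑ ^ 2 ∂strip R ≤
      ENNReal.ofReal (196 * (4 * Real.pi * K 2 ^ 2 * besselConst K * (n * wtSum) ^ 2) *
        (√R * (b * H ^ 3))) := by
  have hb := hc.nonneg
  have hH := hc.nonneg_right
  have hB := besselConst_nonneg K
  set D := 4 * Real.pi * K 2 ^ 2 * besselConst K * (n * wtSum) ^ 2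
  refine (hφ.lintegral_sum_cellProd_le hn hPs hP
    (g := fun i => D * √R * b ^ 2 * ∑ q ∈ cell n s i, ‖c q‖ ^ 2) (fun i => by positivity)
    fun p _ => hφ.lintegral_cellProd_le (by lia) hc p).trans (ENNReal.ofReal_le_ofReal ?_)
  rw [← Finset.mul_sum, sum_sum_cell, mul_assoc 196]
  refine mul_le_mul_of_nonneg_left ?_ (by norm_num)
  calc D * √R * b ^ 2 * ∑ q ∈ s, ‖c q‖ ^ 2 ≤ D * √R * (b * H) * H ^ 2 := by
        rw [sq b]
        gcongr
        · exact hc.le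
        · exact hc.sum_sq_le
    _ = _ := by ring

end IsPacketFamily

end SumPairs

section Whitney

/-- Pairs of equal or adjacent intervals of length `n`. -/
def diagonalPairs (n : ℕ) (s : Finset (Index R)) : Finset (ℤ × ℤ) :=
  {p ∈ cellIndices n s ×ˢ cellIndices n s | |p.1 - p.2| ≤ 1}

/-- Whitney pairs: intervals of length `n` that are neither equal nor adjacent, but whose dyadic
parents are. -/
def separatedPairs (n : ℕ) (s : Finset (Index R)) : Finset (ℤ × ℤ) :=
  {p ∈ cellIndices n s ×ˢ cellIndices n s | |p.1 / 2 - p.2 / 2| ≤ 1 ∧ ¬|p.1 - p.2| ≤ 1}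

theorem fst_mem_of_mem_diagonalPairs {p : ℤ × ℤ} (hp : p ∈ diagonalPairs n s) :
    p.1 ∈ cellIndices n s :=
  (Finset.mem_product.1 (Finset.mem_filter.1 hp).1).1

theorem abs_sub_le_of_mem_diagonalPairs {p : ℤ × ℤ} (hp : p ∈ diagonalPairs n s) :
    |p.1 - p.2| ≤ 1 :=
  (Finset.mem_filter.1 hp).2

theorem fst_mem_of_mem_separatedPairs {p : ℤ × ℤ} (hp : p ∈ separatedPairs n s) :
    p.1 ∈ cellIndices n s :=
  (Finset.mem_product.1 (Finset.mem_filter.1 hp).1).1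

theorem two_le_abs_sub_of_mem_separatedPairs {p : ℤ × ℤ} (hp : p ∈ separatedPairs n s) :
    2 ≤ |p.1 - p.2| := by
  have := (Finset.mem_filter.1 hp).2.2
  lia

theorem abs_sub_le_of_mem_separatedPairs {p : ℤ × ℤ} (hp : p ∈ separatedPairs n s) :
    |p.1 - p.2| ≤ 3 := by
  have := abs_le.1 (Finset.mem_filter.1 hp).2.1
  rw [abs_le]
  lia

section Algebra

variable {α : Type*} [Semiring α]

/-- The sum over `p ∈ P` of the products of the cell sums of `a` indexed by `p.1` and `p.2`. -/
def pairSum (a : Index R → α) (n : ℕ) (s : Finset (Index R)) (P : Finset (ℤ × ℤ)) : α :=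
  ∑ p ∈ P, (∑ q ∈ cell n s p.1, a q) * ∑ q ∈ cell n s p.2, a q

theorem pairSum_filter_product (a : Index R → α) (n : ℕ) (s : Finset (Index R))
    (r : ℤ → ℤ → Prop) [∀ i j, Decidable (r i j)] :
    pairSum a n s {p ∈ cellIndices n s ×ˢ cellIndices n s | r p.1 p.2} =
      ∑ x ∈ s ×ˢ s with r (x.1.1 / (n : ℤ)) (x.2.1 / (n : ℤ)), a x.1 * a x.2 := by
  symm
  rw [pairSum, ← Finset.sum_fiberwise_of_maps_to
    (g := fun x : Index R × Index R => ((x.1.1 : ℤ) / (n : ℤ), (x.2.1 : ℤ) / (n : ℤ)))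
    (t := {p ∈ cellIndices n s ×ˢ cellIndices n s | r p.1 p.2})]
  · refine Finset.sum_congr rfl fun p hp => ?_
    rw [Finset.sum_mul_sum, ← Finset.sum_product']
    refine Finset.sum_congr ?_ fun _ _ => rfl
    have hr := (Finset.mem_filter.1 hp).2
    ext x
    simp only [Finset.mem_filter, Finset.mem_product, cell, Prod.ext_iff]
    grind
  · intro x hx
    obtain ⟨hxs, hr⟩ := Finset.mem_filter.1 hx
    obtain ⟨hx1, hx2⟩ := Finset.mem_product.1 hxs
    exact Finset.mem_filter.2 ⟨Finset.mem_product.2 ⟨Finset.mem_image_of_mem _ hx1,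
      Finset.mem_image_of_mem _ hx2⟩, hr⟩

theorem pairSum_diagonalPairs_two_mul (a : Index R → α) (n : ℕ) (s : Finset (Index R)) :
    pairSum a (n * 2) s (diagonalPairs (n * 2) s) =
      pairSum a n s (diagonalPairs n s) + pairSum a n s (separatedPairs n s) := by
  have hdiv (k : ℤ) : k / ((n * 2 : ℕ) : ℤ) = k / (n : ℤ) / 2 := by
    rw [Int.ediv_ediv_of_nonneg (Nat.cast_nonneg n)]
    push_cast
    rfl
  unfold diagonalPairs separatedPairs
  rw [pairSum_filter_product a (n * 2) s fun i j => |i - j| ≤ 1,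
    pairSum_filter_product a n s fun i j => |i - j| ≤ 1,
    pairSum_filter_product a n s fun i j => |i / 2 - j / 2| ≤ 1 ∧ ¬|i - j| ≤ 1,
    ← Finset.sum_filter_add_sum_filter_not (Finset.filter _ _)
      (fun x : Index R × Index R => |(x.1.1 : ℤ) / (n : ℤ) - x.2.1 / (n : ℤ)| ≤ 1),
    Finset.filter_filter, Finset.filter_filter]
  simp only [hdiv]
  congr 1
  refine Finset.sum_congr (Finset.filter_congr fun x _ => ?_) fun _ _ => rfl
  rw [and_iff_right_iff_imp, abs_le, abs_le]
  lia

theorem pairSum_diagonalPairs_eq_sq (hs : ∀ q ∈ s, |(q.1 : ℤ)| < n) (a : Index R → α) :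
    pairSum a n s (diagonalPairs n s) = (∑ q ∈ s, a q) ^ 2 := by
  have hcell : ∀ q ∈ s, -1 ≤ (q.1 : ℤ) / (n : ℤ) ∧ (q.1 : ℤ) / (n : ℤ) ≤ 0 := by
    intro q hq
    have habs := abs_lt.1 (hs q hq)
    have hn : (0 : ℤ) < n := (abs_nonneg _).trans_lt (hs q hq)
    constructor
    · rw [Int.le_ediv_iff_mul_le hn]
      linarith [habs.1]
    · exact Int.lt_add_one_iff.1 (Int.ediv_lt_of_lt_mul hn (by linarith [habs.2]))
  rw [diagonalPairs, pairSum_filter_product a n s fun i j => |i - j| ≤ 1, sq, Finset.sum_mul_sum,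
    ← Finset.sum_product', Finset.filter_true_of_mem]
  intro x hx
  obtain ⟨hx1, hx2⟩ := Finset.mem_product.1 hx
  have := hcell _ hx1
  have := hcell _ hx2
  rw [abs_le]
  lia

theorem sq_sum_eq_diagonal_add_separated {l₀ L : ℕ}
    (hs : ∀ q ∈ s, |(q.1 : ℤ)| < (2 ^ (l₀ + L) : ℕ)) (a : Index R → α) :
    (∑ q ∈ s, a q) ^ 2 = pairSum a (2 ^ l₀) s (diagonalPairs (2 ^ l₀) s) +
      ∑ l ∈ Finset.range L, pairSum a (2 ^ (l₀ + l)) s (separatedPairs (2 ^ (l₀ + l)) s) := by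
  rw [← pairSum_diagonalPairs_eq_sq hs]
  clear hs
  induction L with
  | zero => rw [add_zero, Finset.sum_range_zero, add_zero]
  | succ L ih =>
    rw [← add_assoc, pow_succ, pairSum_diagonalPairs_two_mul, ih, Finset.sum_range_succ, add_assoc]

end Algebra

end Whitney

section FourthPower

theorem succ_mul_ofReal_add_sum_range_le {x y : ℝ} (hx : 0 ≤ x) (hy : 0 ≤ y) (n : ℕ) :
    (n + 1 : ℕ) * (ENNReal.ofReal x + ∑ _l ∈ Finset.range n, ENNReal.ofReal y) ≤
      ENNReal.ofReal ((n + 1) ^ 2 * (x + y)) := by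
  rw [Finset.sum_const, Finset.card_range, nsmul_eq_mul, ← ENNReal.ofReal_natCast,
    ← ENNReal.ofReal_natCast, ← ENNReal.ofReal_mul (by positivity),
    ← ENNReal.ofReal_add hx (by positivity), ← ENNReal.ofReal_mul (by positivity),
    Nat.cast_add_one]
  refine ENNReal.ofReal_le_ofReal ?_
  have : 0 ≤ ((n : ℝ) + 1) * (n * x + y) := by positivity
  linarith

theorem enorm_add_sum_range_sq_le {E : Type*} [SeminormedAddCommGroup E] (x : E) (y : ℕ → E)
    (L : ℕ) : ‖x + ∑ l ∈ Finset.range L, y l‖ₑ ^ 2 ≤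
      (L + 1 : ℕ) * (‖x‖ₑ ^ 2 + ∑ l ∈ Finset.range L, ‖y l‖ₑ ^ 2) := by
  classical
  have hcard := enorm_sum_sq_le_of_card_le (P := Finset.range (L + 1))
    (z := fun l => Nat.casesOn (motive := fun _ => E) l x y)
    ((Finset.card_filter_le _ _).trans_eq (Finset.card_range _))
  rw [Finset.sum_range_succ', Finset.sum_range_succ', add_comm, add_comm (∑ l ∈ _, _)] at hcard
  exact hcard

/-- The constant of the `L⁴` bound for finite sums of wave packets, before optimising `ρ`. -/
def whitneyConst (K : ℕ → ℝ) (N : ℕ) : ℝ :=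
  196 * (4 * Real.pi * K 2 ^ 2 * besselConst K * ((8 : ℕ) * wtSum) ^ 2) +
    196 * (nearConst K + 3 * farConst K N)

theorem exists_sqrt_lt_two_pow {δ : ℝ} (hδ : 0 < δ) (hR : 1 ≤ R) :
    ∃ L : ℕ, √R < 2 ^ L ∧ (L : ℝ) + 1 ≤ (1 / (δ * Real.log 2) + 2) * R ^ δ := by
  have hR0 : 0 < R := by linarith
  have hlog2 : 0 < Real.log 2 := Real.log_pos one_lt_two
  refine ⟨Nat.log 2 ⌊R⌋₊ + 1, ?_, ?_⟩
  · have hlt : ⌊R⌋₊ < 2 ^ (Nat.log 2 ⌊R⌋₊ + 1) := Nat.lt_pow_succ_log_self one_lt_two _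
    exact (Real.sqrt_le_self_iff.2 (Or.inr hR)).trans_lt
      (by exact_mod_cast (Nat.floor_lt hR0.le).1 hlt)
  have hpow : (2 : ℝ) ^ Nat.log 2 ⌊R⌋₊ ≤ R :=
    calc (2 : ℝ) ^ Nat.log 2 ⌊R⌋₊ ≤ ⌊R⌋₊ := by
          exact_mod_cast Nat.pow_log_le_self 2 (Nat.floor_pos.2 hR).ne'
      _ ≤ R := Nat.floor_le hR0.le
  have hlog : Nat.log 2 ⌊R⌋₊ * Real.log 2 ≤ R ^ δ / δ :=
    calc Nat.log 2 ⌊R⌋₊ * Real.log 2 = Real.log (2 ^ Nat.log 2 ⌊R⌋₊) := (Real.log_pow _ _).symm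
      _ ≤ Real.log R := Real.log_le_log (by positivity) hpow
      _ ≤ R ^ δ / δ := Real.log_le_rpow_div hR0.le hδ
  have hL : (Nat.log 2 ⌊R⌋₊ : ℝ) ≤ 1 / (δ * Real.log 2) * R ^ δ :=
    calc (Nat.log 2 ⌊R⌋₊ : ℝ) ≤ R ^ δ / δ / Real.log 2 := (le_div_iff₀ hlog2).2 hlog
      _ = _ := by field_simp
  push_cast
  linarith [Real.one_le_rpow hR hδ.le]

namespace IsPacketFamily

variable (hφ : IsPacketFamily R K φ)

include hφ

theorem pairSum_eq_sum_cellProd (c : Index R → ℂ) (n : ℕ) (s : Finset (Index R))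
    (P : Finset (ℤ × ℤ)) (z : ℝ × ℝ) :
    pairSum (fun q => c q * extensionOp (φ q) z.1 z.2) n s P =
      ∑ p ∈ P, cellProd c φ n s p z := by
  simp only [pairSum, cellProd, hφ.wave_eq_sum]

theorem wave_sq_eq {L : ℕ} (hL : √R < 2 ^ L) (c : Index R → ℂ) (s : Finset (Index R))
    (z : ℝ × ℝ) :
    wave c φ s z ^ 2 = ∑ p ∈ diagonalPairs 8 s, cellProd c φ 8 s p z +
      ∑ l ∈ Finset.range L, ∑ p ∈ separatedPairs (2 ^ (3 + l)) s,
        cellProd c φ (2 ^ (3 + l)) s p z := by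
  have hs : ∀ q ∈ s, |(q.1 : ℤ)| < (2 ^ (3 + L) : ℕ) := by
    intro q _
    have hlt : |((q.1 : ℤ) : ℝ)| < 2 ^ (3 + L) :=
      (abs_freqIndex_le hφ.radius_pos q).trans_lt
        (hL.trans_le (pow_le_pow_right₀ one_le_two (by lia)))
    exact_mod_cast hlt
  have hwhitney := sq_sum_eq_diagonal_add_separated hs fun q => c q * extensionOp (φ q) z.1 z.2
  simp only [hφ.pairSum_eq_sum_cellProd, ← hφ.wave_eq_sum] at hwhitney
  exact hwhitney

theorem lintegral_wave_pow_four_le_sum {L : ℕ} (hL : √R < 2 ^ L) (c : Index R → ℂ)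
    (s : Finset (Index R)) :
    ∫⁻ z, ‖wave c φ s z‖ₑ ^ 4 ∂strip R ≤ (L + 1 : ℕ) *
      (∫⁻ z, ‖∑ p ∈ diagonalPairs 8 s, cellProd c φ 8 s p z‖ₑ ^ 2 ∂strip R +
        ∑ l ∈ Finset.range L, ∫⁻ z, ‖∑ p ∈ separatedPairs (2 ^ (3 + l)) s,
          cellProd c φ (2 ^ (3 + l)) s p z‖ₑ ^ 2 ∂strip R) := by
  have hmeas (n : ℕ) (P : Finset (ℤ × ℤ)) :
      Measurable fun z => ‖∑ p ∈ P, cellProd c φ n s p z‖ₑ ^ 2 :=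
    (continuous_finsetSum _ fun p _ =>
      hφ.continuous_cellProd c n s p).measurable.enorm.pow_const 2
  rw [← lintegral_finsetSum _ fun l _ => hmeas _ _, ← lintegral_add_left (hmeas _ _),
    ← lintegral_const_mul' _ _ (ENNReal.natCast_ne_top _)]
  refine lintegral_mono fun z => ?_
  rw [show 4 = 2 * 2 from rfl, pow_mul, ← enorm_pow, hφ.wave_sq_eq hL]
  exact enorm_add_sum_range_sq_le _ _ _

theorem lintegral_wave_pow_four_le_of_sqrt_lt (hR : 1 ≤ R) {N : ℕ} (hρ : 1 ≤ ρ)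
    (hN : R ^ 3 ≤ (ρ ^ N) ^ 2) {L : ℕ} (hL : √R < 2 ^ L) (hc : IsCoeffBound c s b H) :
    ∫⁻ z, ‖wave c φ s z‖ₑ ^ 4 ∂strip R ≤
      ENNReal.ofReal (whitneyConst K N * (L + 1) ^ 2 * (ρ ^ 2 * √R * (b * H ^ 3))) := by
  have hb := hc.nonneg
  have hH := hc.nonneg_right
  have hnear := nearConst_nonneg K
  have hfar := farConst_nonneg K N
  have hB := besselConst_nonneg K
  set Y := ρ ^ 2 * √R * (b * H ^ 3) with hY
  set C₁ := 196 * (4 * Real.pi * K 2 ^ 2 * besselConst K * ((8 : ℕ) * wtSum) ^ 2)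
  set C₂ := 196 * (nearConst K + 3 * farConst K N)
  have hdiag := calc
    ∫⁻ z, ‖∑ p ∈ diagonalPairs 8 s, cellProd c φ 8 s p z‖ₑ ^ 2 ∂strip R
      ≤ ENNReal.ofReal (C₁ * (√R * (b * H ^ 3))) :=
        hφ.lintegral_diagonal_pairs_le le_rfl (fun p => fst_mem_of_mem_diagonalPairs)
          (fun p hp => (abs_sub_le_of_mem_diagonalPairs hp).trans (by norm_num)) hc
    _ ≤ ENNReal.ofReal (C₁ * Y) := by
        rw [hY, mul_assoc (ρ ^ 2)]
        exact ENNReal.ofReal_le_ofReal (mul_le_mul_of_nonneg_left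
          (le_mul_of_one_le_left (by positivity) (one_le_pow₀ hρ)) (by positivity))
  have hsep (l : ℕ) : ∫⁻ z, ‖∑ p ∈ separatedPairs (2 ^ (3 + l)) s,
      cellProd c φ (2 ^ (3 + l)) s p z‖ₑ ^ 2 ∂strip R ≤ ENNReal.ofReal (C₂ * Y) :=
    hφ.lintegral_separated_pairs_le hR
      (Nat.pow_le_pow_right two_pos (Nat.le_add_right 3 l) : 2 ^ 3 ≤ _)
      (fun p => fst_mem_of_mem_separatedPairs) (fun p => two_le_abs_sub_of_mem_separatedPairs)
      (fun p => abs_sub_le_of_mem_separatedPairs) hρ hN hc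
  calc _ ≤ (L + 1 : ℕ) * (ENNReal.ofReal (C₁ * Y) +
        ∑ _l ∈ Finset.range L, ENNReal.ofReal (C₂ * Y)) :=
        (hφ.lintegral_wave_pow_four_le_sum hL c s).trans <|
          mul_le_mul_right (add_le_add hdiag (Finset.sum_le_sum fun l _ => hsep l)) _
    _ ≤ ENNReal.ofReal ((L + 1) ^ 2 * (C₁ * Y + C₂ * Y)) :=
        succ_mul_ofReal_add_sum_range_le (by positivity) (by positivity) L
    _ = _ := by
        congr 1
        rw [whitneyConst]
        ring

omit hφ in
theorem exists_lintegral_wave_pow_four_le (K : ℕ → ℝ) {δ : ℝ} (hδ : 0 < δ) :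
    ∃ C : ℝ, 0 ≤ C ∧ ∀ {R : ℝ} {φ : Index R → ℝ → ℂ}, IsPacketFamily R K φ → 1 ≤ R →
      ∀ {c : Index R → ℂ} {s : Finset (Index R)} {b H : ℝ}, IsCoeffBound c s b H →
      ∫⁻ z, ‖wave c φ s z‖ₑ ^ 4 ∂strip R ≤
        ENNReal.ofReal (C * R ^ (1 / 2 + 4 * δ) * (b * H ^ 3)) := by
  obtain ⟨N, hN⟩ := exists_nat_ge (3 / (2 * δ))
  have hC : 0 ≤ whitneyConst K N := by
    have := nearConst_nonneg K
    have := farConst_nonneg K N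
    have := besselConst_nonneg K
    unfold whitneyConst
    positivity
  refine ⟨whitneyConst K N * (1 / (δ * Real.log 2) + 2) ^ 2, by positivity, ?_⟩
  intro R φ hφ hR c s b H hc
  have hR0 : 0 < R := by linarith
  have hb := hc.nonneg
  have hH := hc.nonneg_right
  have hρ : R ^ 3 ≤ ((R ^ δ) ^ N) ^ 2 := by
    rw [← pow_mul, ← Real.rpow_natCast, ← Real.rpow_natCast, ← Real.rpow_mul hR0.le]
    refine Real.rpow_le_rpow_of_exponent_le hR ?_
    rw [div_le_iff₀ (by positivity)] at hN
    push_cast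
    linarith
  have hexp : R ^ (1 / 2 + 4 * δ) = (R ^ δ) ^ 2 * ((R ^ δ) ^ 2 * √R) := by
    rw [Real.sqrt_eq_rpow, ← Real.rpow_natCast, ← Real.rpow_mul hR0.le, ← Real.rpow_add hR0,
      ← Real.rpow_add hR0]
    congr 1
    push_cast
    ring
  obtain ⟨L, hL, hLR⟩ := exists_sqrt_lt_two_pow hδ hR
  refine (hφ.lintegral_wave_pow_four_le_of_sqrt_lt hR (Real.one_le_rpow hR hδ.le) hρ hL hc).trans
    (ENNReal.ofReal_le_ofReal ?_)
  calc _ ≤ whitneyConst K N * ((1 / (δ * Real.log 2) + 2) * R ^ δ) ^ 2 *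
        ((R ^ δ) ^ 2 * √R * (b * H ^ 3)) := by gcongr
    _ = _ := by rw [hexp]; ring

end IsPacketFamily

end FourthPower

end CellPairs

section Disc

variable {R : ℝ}

theorem abs_fst_le_of_mem_disc (hR : 0 ≤ R) {z : ℝ × ℝ} (hz : z ∈ disc R) : |z.1| ≤ R :=
  abs_le_of_sq_le_sq ((le_add_of_nonneg_right (sq_nonneg z.2)).trans hz) hR

theorem abs_snd_le_of_mem_disc (hR : 0 ≤ R) {z : ℝ × ℝ} (hz : z ∈ disc R) : |z.2| ≤ R :=
  abs_le_of_sq_le_sq ((le_add_of_nonneg_left (sq_nonneg z.1)).trans hz) hR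

theorem measurableSet_disc (R : ℝ) : MeasurableSet (disc R) :=
  measurableSet_le (by fun_prop) measurable_const

theorem restrict_disc_le_strip (hR : 0 ≤ R) : volume.restrict (disc R) ≤ strip R := by
  have hstrip : strip R = (volume : Measure (ℝ × ℝ)).restrict (univ ×ˢ Icc (-R) R) := by
    rw [strip, Measure.volume_eq_prod, ← Measure.prod_restrict, Measure.restrict_univ]
  rw [hstrip]
  exact Measure.restrict_mono_set _ fun z hz =>
    ⟨mem_univ _, abs_le.1 (abs_snd_le_of_mem_disc hR hz)⟩

theorem volume_disc_le (hR : 0 ≤ R) : volume (disc R) ≤ ENNReal.ofReal (4 * R ^ 2) :=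
  calc volume (disc R) ≤ volume (Icc (-R) R ×ˢ Icc (-R) R) := measure_mono fun _ hz =>
        ⟨abs_le.1 (abs_fst_le_of_mem_disc hR hz), abs_le.1 (abs_snd_le_of_mem_disc hR hz)⟩
    _ = ENNReal.ofReal (4 * R ^ 2) := by
        rw [Measure.volume_eq_prod, Measure.prod_prod, Real.volume_Icc,
          ← ENNReal.ofReal_mul (by linarith)]
        congr 1
        ring

theorem eLpNorm_four_eq {α : Type*} [MeasurableSpace α] (μ : Measure α) (g : α → ℂ) :
    eLpNorm g 4 μ = (∫⁻ x, ‖g x‖ₑ ^ 4 ∂μ) ^ (1 / 4 : ℝ) := by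
  have hfour : (4 : ℝ≥0∞).toReal = ((4 : ℕ) : ℝ) := by norm_num
  rw [eLpNorm_eq_lintegral_rpow_enorm_toReal (by norm_num) (by norm_num)]
  simp only [hfour, ENNReal.rpow_natCast]
  norm_num

end Disc

theorem IsPacketFamily.support_packetSum_subset {R : ℝ} {K : ℕ → ℝ} {φ : Index R → ℝ → ℂ}
    (hφ : IsPacketFamily R K φ) (c : Index R → ℂ) (u : Finset (Index R)) :
    Function.support (packetSum c φ u) ⊆ Icc (-(1 + 3 / √R)) (1 + 3 / √R) := by
  intro ω hω
  have hr : 0 < √R := Real.sqrt_pos.2 hφ.radius_pos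
  obtain ⟨q, -, hq⟩ := Finset.exists_ne_zero_of_sum_ne_zero hω
  have hsupp := abs_le.1 (hφ.support q ω (right_ne_zero_of_mul hq))
  have hfreq := abs_le.1 (abs_freqIndex_le hφ.radius_pos q)
  rw [mem_Icc, ← abs_le, one_add_div hr.ne', le_div_iff₀ hr, ← abs_of_pos hr, ← abs_mul,
    abs_of_pos hr, abs_le]
  constructor <;> linarith

/-- The constant in `S ≤ sizeConst A K`, the trivial bound for the size ratio. -/
def sizeConst (A : ℝ≥0) (K : ℕ → ℝ) : ℝ≥0 :=
  NNReal.sqrt ((besselConst K).toNNReal * A)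

namespace IsDecomposition

variable {R : ℝ} {A : ℝ≥0} {K : ℕ → ℝ} {f : ℝ → ℂ} {c : Index R → ℂ} {φ : Index R → ℝ → ℂ}

theorem isPacketFamily (h : IsDecomposition R A K f c φ) (hR : 0 < R) :
    IsPacketFamily R K φ where
  radius_pos := hR
  memLp := h.memLp
  support := by
    rintro ⟨⟨k, hk⟩, m⟩ ω hω
    have hr : 0 < √R := Real.sqrt_pos.2 hR
    have hmem : ω ∈ Icc (k * (√R)⁻¹ - 3 * (√R)⁻¹) (k * (√R)⁻¹ + 3 * (√R)⁻¹) := by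
      simpa only [freq, Real.rpow_neg hR.le, ← Real.sqrt_eq_rpow] using h.support_subset _ hω
    rw [mem_Icc, ← sub_mul, ← add_mul, ← div_eq_mul_inv, ← div_eq_mul_inv, div_le_iff₀ hr,
      le_div_iff₀ hr] at hmem
    exact abs_le.2 ⟨by linarith, by linarith⟩
  decay := by
    rintro ⟨⟨k, hk⟩, m⟩ N hN x t ht
    have hr : 0 < √R := Real.sqrt_pos.2 hR
    have hrescale : |x - m * √R + 2 * (k * (√R)⁻¹) * t| * (√R)⁻¹ =
        |x / √R - m + 2 * k * (t / R)| := by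
      conv_lhs => rw [← abs_of_pos (inv_pos.2 hr), ← abs_mul, abs_of_pos (inv_pos.2 hr)]
      congr 1
      nth_rewrite 5 [← Real.mul_self_sqrt hR.le]
      field_simp
    have hdecay := h.decay (⟨k, hk⟩, m) N hN x t ht
    simp only [freq, pos, Real.rpow_neg hR.le (1 / 2), ← Real.sqrt_eq_rpow, hrescale] at hdecay
    exact hdecay

theorem memLp_of_aestronglyMeasurable (h : IsDecomposition R A K f c φ) (hR : 0 < R)
    (hf : AEStronglyMeasurable f) : MemLp f 2 := by
  obtain ⟨s, hs⟩ := (h.sum_eq.eventually (gt_mem_nhds one_pos)).exists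
  have hsum : MemLp (packetSum c φ s) 2 := (h.isPacketFamily hR).memLp_packetSum c s
  have hdiff : MemLp (f - packetSum c φ s) 2 :=
    ⟨hf.sub hsum.1, hs.trans ENNReal.one_lt_top⟩
  simpa using hdiff.add hsum

theorem ae_eq_zero_compl (h : IsDecomposition R A K f c φ) (hR : 0 < R)
    (hf : AEStronglyMeasurable f) :
    f =ᵐ[volume.restrict (Icc (-(1 + 3 / √R)) (1 + 3 / √R))ᶜ] 0 :=
  ae_eq_zero_compl_of_tendsto_eLpNorm_sub two_ne_zero hf measurableSet_Icc
    ((h.isPacketFamily hR).support_packetSum_subset c) h.sum_eq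

theorem tendsto_wave (h : IsDecomposition R A K f c φ) (hR : 0 < R) (hf : MemLp f 2)
    (z : ℝ × ℝ) :
    Tendsto (fun s => wave c φ s z) atTop (𝓝 (extensionOp f z.1 z.2)) := by
  set S := Icc (-(1 + 3 / √R)) (1 + 3 / √R)
  have hφ := h.isPacketFamily hR
  have hfS : f =ᵐ[volume.restrict Sᶜ] 0 := h.ae_eq_zero_compl hR hf.1
  have hS : volume S ≠ ∞ := measure_Icc_lt_top.ne
  have hfint := integrable_of_ae_eq_zero_compl hf measurableSet_Icc hS hfS
  have hle (s : Finset (Index R)) : edist (wave c φ s z) (extensionOp f z.1 z.2) ≤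
      volume S ^ (1 / 2 : ℝ) * eLpNorm (fun ω => f ω - packetSum c φ s ω) 2 volume := by
    have hsum := hφ.integrable_packetSum c s
    rw [edist_comm, edist_eq_enorm_sub, ← extensionOp_sub hfint hsum]
    refine (enorm_extensionOp_le _ _ _).trans
      (lintegral_enorm_le_of_ae_eq_zero_compl (hf.1.sub hsum.1) measurableSet_Icc ?_)
    filter_upwards [hfS, ae_restrict_mem measurableSet_Icc.compl] with ω hω hωS
    have : packetSum c φ s ω = 0 :=
      Function.notMem_support.1 fun hne => hωS (hφ.support_packetSum_subset c s hne)
    simp [hω, this]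
  have hlim := ENNReal.Tendsto.const_mul h.sum_eq
    (Or.inr (ENNReal.rpow_ne_top_of_nonneg one_half_pos.le hS))
  rw [mul_zero] at hlim
  exact tendsto_iff_edist_tendsto_0.2 <|
    tendsto_of_tendsto_of_tendsto_of_le_of_le tendsto_const_nhds hlim (fun _ => zero_le) hle

theorem eLpNorm_extensionOp_le (h : IsDecomposition R A K f c φ) (hR : 0 < R) (hf : MemLp f 2)
    {p : ℝ≥0∞} {μ : Measure (ℝ × ℝ)} {B : ℝ≥0∞}
    (hB : ∀ s, eLpNorm (wave c φ s) p μ ≤ B) :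
    eLpNorm (fun z : ℝ × ℝ => extensionOp f z.1 z.2) p μ ≤ B := by
  obtain ⟨u, hu⟩ := exists_seq_tendsto (atTop : Filter (Finset (Index R)))
  refine (Lp.eLpNorm_lim_le_liminf_eLpNorm
    (fun n => ((h.isPacketFamily hR).continuous_wave c (u n)).aestronglyMeasurable) _
    (Eventually.of_forall fun z => (h.tendsto_wave hR hf z).comp hu)).trans ?_
  refine liminf_le_of_le (by isBoundedDefault) fun b hb => ?_
  obtain ⟨n, hn⟩ := hb.exists
  exact hn.trans (hB _)

theorem sum_norm_coeff_sq_le (h : IsDecomposition R A K f c φ) (hf : MemLp f 2)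
    (s : Finset (Index R)) :
    ∑ q ∈ s, ‖c q‖ ^ 2 ≤ (√A * (eLpNorm f 2 volume).toReal) ^ 2 := by
  have hsum := ENNReal.toReal_mono
    (ENNReal.mul_ne_top ENNReal.coe_ne_top (ENNReal.pow_ne_top hf.2.ne))
    ((ENNReal.sum_le_tsum s).trans h.sum_sq_le)
  rw [ENNReal.toReal_sum (fun q _ => by finiteness)] at hsum
  simpa [mul_pow, Real.sq_sqrt A.coe_nonneg] using hsum

theorem maxPacket_le (h : IsDecomposition R A K f c φ) (hR : 0 < R) :
    maxPacket c φ ≤ sizeConst A K * eLpNorm f 2 volume := by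
  refine iSup_le fun q => (ENNReal.pow_le_pow_left_iff two_ne_zero).1 ?_
  calc eLpNorm (packet c φ q) 2 volume ^ 2
      ≤ ENNReal.ofReal (besselConst K * ‖c q‖ ^ 2) := by
        simpa [packetSum, eLpNorm_two_sq] using
          (h.isPacketFamily hR).lintegral_packetSum_sq_le c {q}
    _ = ENNReal.ofReal (besselConst K) * ‖c q‖ₑ ^ 2 := by
        rw [ENNReal.ofReal_mul (besselConst_nonneg K), enorm_sq_eq_ofReal]
    _ ≤ ENNReal.ofReal (besselConst K) * (A * eLpNorm f 2 volume ^ 2) := by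
        gcongr
        exact (ENNReal.le_tsum q).trans h.sum_sq_le
    _ = (sizeConst A K * eLpNorm f 2 volume) ^ 2 := by
        rw [mul_pow, ← ENNReal.coe_pow, sizeConst, NNReal.sq_sqrt, ENNReal.coe_mul, mul_assoc]
        rfl

theorem maxPacket_ne_top (h : IsDecomposition R A K f c φ) (hR : 0 < R) (hf : MemLp f 2) :
    maxPacket c φ ≠ ∞ :=
  ((h.maxPacket_le hR).trans_lt (ENNReal.mul_lt_top ENNReal.coe_lt_top hf.2)).ne

theorem maxPacket_ne_zero (h : IsDecomposition R A K f c φ) (hf0 : eLpNorm f 2 volume ≠ 0) :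
    maxPacket c φ ≠ 0 := by
  intro hM
  have hc : ∀ q, ‖c q‖ₑ = 0 := fun q => by simpa [hM] using h.coeff_le q
  exact hf0 (by simpa [hc] using h.le_sum_sq)

theorem norm_coeff_le (h : IsDecomposition R A K f c φ) (hR : 0 < R) (hf : MemLp f 2)
    (q : Index R) : ‖c q‖ ≤ A * (maxPacket c φ).toReal := by
  simpa using ENNReal.toReal_mono
    (ENNReal.mul_ne_top ENNReal.coe_ne_top (h.maxPacket_ne_top hR hf)) (h.coeff_le q)

theorem isCoeffBound (h : IsDecomposition R A K f c φ) (hR : 0 < R) (hf : MemLp f 2)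
    (s : Finset (Index R)) :
    IsCoeffBound c s
      (min (A * (maxPacket c φ).toReal) (√A * (eLpNorm f 2 volume).toReal))
      (√A * (eLpNorm f 2 volume).toReal) where
  nonneg := by positivity
  le := min_le_right _ _
  norm_le q _ := le_min (h.norm_coeff_le hR hf q) <|
    le_of_sq_le_sq (by simpa using h.sum_norm_coeff_sq_le hf {q}) (by positivity)
  sum_sq_le := h.sum_norm_coeff_sq_le hf s

theorem eLpNorm_extensionOp_le_of_lintegral_wave_le (h : IsDecomposition R A K f c φ) (hR : 0 < R)
    (hf : MemLp f 2) {C α : ℝ} (hC : 0 ≤ C)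
    (hwave : ∀ {s b H}, IsCoeffBound c s b H →
      ∫⁻ z, ‖wave c φ s z‖ₑ ^ 4 ∂strip R ≤ ENNReal.ofReal (C * R ^ α * (b * H ^ 3))) :
    eLpNorm (fun z : ℝ × ℝ => extensionOp f z.1 z.2) 4 (volume.restrict (disc R)) ≤
      (ENNReal.ofReal (C * (A * √A ^ 3)) * ENNReal.ofReal (R ^ α) *
        (maxPacket c φ * eLpNorm f 2 volume ^ 3)) ^ (1 / 4 : ℝ) := by
  refine h.eLpNorm_extensionOp_le hR hf fun s => ?_
  rw [eLpNorm_four_eq]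
  refine ENNReal.rpow_le_rpow ?_ (by norm_num)
  set M := (maxPacket c φ).toReal with hM
  set F := (eLpNorm f 2 volume).toReal with hF
  have : 0 ≤ R ^ α := Real.rpow_nonneg hR.le _
  calc _ ≤ ∫⁻ z, ‖wave c φ s z‖ₑ ^ 4 ∂strip R :=
        lintegral_mono' (restrict_disc_le_strip hR.le) le_rfl
    _ ≤ ENNReal.ofReal (C * R ^ α * (min (A * M) (√A * F) * (√A * F) ^ 3)) :=
        hwave (h.isCoeffBound hR hf s)
    _ ≤ ENNReal.ofReal (C * R ^ α * (A * M * (√A * F) ^ 3)) := by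
        gcongr
        exact min_le_left _ _
    _ = ENNReal.ofReal (C * (A * √A ^ 3) * R ^ α * (M * F ^ 3)) := by
        congr 1
        ring
    _ = _ := by
        rw [ENNReal.ofReal_mul (by positivity), ENNReal.ofReal_mul (by positivity),
          ENNReal.ofReal_mul (p := M) (by positivity), ENNReal.ofReal_pow (by positivity), hM, hF,
          ENNReal.ofReal_toReal (h.maxPacket_ne_top hR hf), ENNReal.ofReal_toReal hf.2.ne]

theorem exists_eLpNorm_extensionOp_le_of_one_le (A : ℝ≥0) (K : ℕ → ℝ) {ε : ℝ} (hε : 0 < ε) :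
    ∃ C : ℝ≥0, ∀ {R : ℝ} {f : ℝ → ℂ} {c : Index R → ℂ} {φ : Index R → ℝ → ℂ},
      IsDecomposition R A K f c φ → 1 ≤ R → MemLp f 2 →
      eLpNorm (fun z : ℝ × ℝ => extensionOp f z.1 z.2) 4 (volume.restrict (disc R)) ≤
        C * ENNReal.ofReal (R ^ (1 / 8 + ε)) *
          (maxPacket c φ ^ (1 / 4 : ℝ) * eLpNorm f 2 volume ^ (3 / 4 : ℝ)) := by
  obtain ⟨C, hC, hwave⟩ := IsPacketFamily.exists_lintegral_wave_pow_four_le K hε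
  refine ⟨(C * (A * √A ^ 3)).toNNReal ^ (1 / 4 : ℝ), fun {R f c φ} h hR hf => ?_⟩
  have hR0 : 0 < R := one_pos.trans_le hR
  refine (h.eLpNorm_extensionOp_le_of_lintegral_wave_le hR0 hf hC
    (hwave (h.isPacketFamily hR0) hR)).trans_eq ?_
  have hquarter : (0 : ℝ) ≤ 1 / 4 := by norm_num
  rw [ENNReal.mul_rpow_of_nonneg _ _ hquarter, ENNReal.mul_rpow_of_nonneg _ _ hquarter,
    ENNReal.mul_rpow_of_nonneg _ _ hquarter, ENNReal.coe_rpow_of_nonneg _ hquarter,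
    ENNReal.ofReal_rpow_of_pos (Real.rpow_pos_of_pos hR0 _), ← Real.rpow_mul hR0.le,
    ← ENNReal.rpow_natCast, ← ENNReal.rpow_mul]
  congr 3
  · ring_nf
  · norm_num

theorem enorm_extensionOp_le_of_lt_one (h : IsDecomposition R A K f c φ) (hR : 0 < R)
    (hR1 : R < 1) (hf : MemLp f 2) {z : ℝ × ℝ} (hz : |z.2| ≤ R) :
    ‖extensionOp f z.1 z.2‖ₑ ≤
      ENNReal.ofReal (K 2 * R ^ (-(1 / 4) : ℝ) * (A * wtSum)) * maxPacket c φ := by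
  have hφ := h.isPacketFamily hR
  have hK := hφ.nonneg_const two_pos
  have hW := wtSum_nonneg
  refine le_of_tendsto (h.tendsto_wave hR hf z).enorm (Eventually.of_forall fun s => ?_)
  have hfreq : ∀ q ∈ s, (q.1 : ℤ) ∈ ({0} : Finset ℤ) := fun q _ => by
    have hq : |((q.1 : ℤ) : ℝ)| < 1 := (abs_freqIndex_le hR q).trans_lt <|
      (Real.sqrt_lt' one_pos).2 (by simpa using hR1)
    exact Finset.mem_singleton.2 (Int.abs_lt_one_iff.1 (by exact_mod_cast hq))
  have hmaj := majorant_le hfreq (by positivity) (fun q _ => h.norm_coeff_le hR hf q)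
    (z.1 / √R) (z.2 / R)
  rw [← ofReal_norm, ← ENNReal.ofReal_toReal (h.maxPacket_ne_top hR hf),
    ← ENNReal.ofReal_mul (by positivity)]
  refine ENNReal.ofReal_le_ofReal ?_
  calc _ ≤ K 2 * R ^ (-(1 / 4) : ℝ) *
        (A * (maxPacket c φ).toReal * (({0} : Finset ℤ).card * wtSum)) :=
        (hφ.norm_wave_le c s hz).trans (mul_le_mul_of_nonneg_left hmaj (by positivity))
    _ = _ := by
        rw [Finset.card_singleton]
        push_cast
        ring

theorem maxPacket_le_rpow_mul_rpow (h : IsDecomposition R A K f c φ) (hR : 0 < R) :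
    maxPacket c φ ≤ sizeConst A K ^ (3 / 4 : ℝ) *
      (maxPacket c φ ^ (1 / 4 : ℝ) * eLpNorm f 2 volume ^ (3 / 4 : ℝ)) := by
  calc maxPacket c φ = maxPacket c φ ^ (1 / 4 : ℝ) * maxPacket c φ ^ (3 / 4 : ℝ) := by
        rw [← ENNReal.rpow_add_of_nonneg _ _ (by norm_num) (by norm_num)]
        norm_num
    _ ≤ maxPacket c φ ^ (1 / 4 : ℝ) * (sizeConst A K * eLpNorm f 2 volume) ^ (3 / 4 : ℝ) := by
        gcongr
        exact h.maxPacket_le hR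
    _ = _ := by
        rw [ENNReal.mul_rpow_of_nonneg _ _ (by norm_num)]
        ring

theorem exists_eLpNorm_extensionOp_le_of_lt_one (A : ℝ≥0) (K : ℕ → ℝ) :
    ∃ C : ℝ≥0, ∀ {R : ℝ} {f : ℝ → ℂ} {c : Index R → ℂ} {φ : Index R → ℝ → ℂ},
      IsDecomposition R A K f c φ → 0 < R → R < 1 → MemLp f 2 →
      eLpNorm (fun z : ℝ × ℝ => extensionOp f z.1 z.2) 4 (volume.restrict (disc R)) ≤
        C * ENNReal.ofReal (R ^ (1 / 4 : ℝ)) *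
          (maxPacket c φ ^ (1 / 4 : ℝ) * eLpNorm f 2 volume ^ (3 / 4 : ℝ)) := by
  set D := 4 ^ (1 / 4 : ℝ) * (K 2 * (A * wtSum))
  refine ⟨D.toNNReal * sizeConst A K ^ (3 / 4 : ℝ), fun {R f c φ} h hR hR1 hf => ?_⟩
  have hK := (h.isPacketFamily hR).nonneg_const two_pos
  have hW := wtSum_nonneg
  have hpow : ((4 : ℝ) * R ^ 2) ^ (1 / 4 : ℝ) * R ^ (-(1 / 4) : ℝ) =
      4 ^ (1 / 4 : ℝ) * R ^ (1 / 4 : ℝ) := by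
    rw [Real.mul_rpow (by norm_num) (by positivity), ← Real.rpow_natCast R 2,
      ← Real.rpow_mul hR.le, mul_assoc, ← Real.rpow_add hR]
    norm_num
  calc _ ≤ ENNReal.ofReal (K 2 * R ^ (-(1 / 4) : ℝ) * (A * wtSum)) * maxPacket c φ *
        volume (disc R) ^ (1 / 4 : ℝ) := by
        have hle := eLpNorm_le_of_ae_enorm_bound (p := 4) (μ := volume.restrict (disc R)) <|
          ae_restrict_of_forall_mem (measurableSet_disc R) fun z hz =>
            h.enorm_extensionOp_le_of_lt_one hR hR1 hf (abs_snd_le_of_mem_disc hR.le hz)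
        simpa using hle
    _ ≤ ENNReal.ofReal (K 2 * R ^ (-(1 / 4) : ℝ) * (A * wtSum)) * maxPacket c φ *
        ENNReal.ofReal (4 * R ^ 2) ^ (1 / 4 : ℝ) := by
        gcongr
        exact volume_disc_le hR.le
    _ = ENNReal.ofReal (D * R ^ (1 / 4 : ℝ)) * maxPacket c φ := by
        rw [ENNReal.ofReal_rpow_of_nonneg (by positivity) (by norm_num), mul_right_comm,
          ← ENNReal.ofReal_mul (by positivity)]
        congr 2
        linear_combination K 2 * (A * wtSum) * hpow
    _ ≤ ENNReal.ofReal (D * R ^ (1 / 4 : ℝ)) * (sizeConst A K ^ (3 / 4 : ℝ) *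
        (maxPacket c φ ^ (1 / 4 : ℝ) * eLpNorm f 2 volume ^ (3 / 4 : ℝ))) :=
        mul_le_mul_right (h.maxPacket_le_rpow_mul_rpow hR) _
    _ = _ := by
        rw [ENNReal.coe_mul, ENNReal.ofReal_mul (by positivity),
          ENNReal.coe_rpow_of_nonneg _ (by norm_num), ENNReal.ofReal]
        ring

theorem exists_eLpNorm_extensionOp_le (A : ℝ≥0) (K : ℕ → ℝ) {ε : ℝ} (hε : 0 < ε) :
    ∃ C : ℝ≥0, ∀ {R : ℝ} {f : ℝ → ℂ} {c : Index R → ℂ} {φ : Index R → ℝ → ℂ},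
      IsDecomposition R A K f c φ → 0 < R → (ε ≤ 1 / 8 ∨ 1 ≤ R) → MemLp f 2 →
      eLpNorm (fun z : ℝ × ℝ => extensionOp f z.1 z.2) 4 (volume.restrict (disc R)) ≤
        C * ENNReal.ofReal (R ^ (1 / 8 + ε)) *
          (maxPacket c φ ^ (1 / 4 : ℝ) * eLpNorm f 2 volume ^ (3 / 4 : ℝ)) := by
  obtain ⟨C₁, hlarge⟩ := exists_eLpNorm_extensionOp_le_of_one_le A K hε
  obtain ⟨C₂, hsmall⟩ := exists_eLpNorm_extensionOp_le_of_lt_one A K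
  refine ⟨max C₁ C₂, fun {R f c φ} h hR hRε hf => ?_⟩
  rcases le_or_gt 1 R with hR1 | hR1
  · refine (hlarge h hR1 hf).trans ?_
    gcongr
    exact le_max_left _ _
  · have hexp : 1 / 8 + ε ≤ 1 / 4 := by linarith [hRε.resolve_right hR1.not_ge]
    refine (hsmall h hR hR1 hf).trans ?_
    gcongr ?_ * ENNReal.ofReal ?_ * _
    · exact_mod_cast le_max_right _ _
    · exact Real.rpow_le_rpow_of_exponent_ge hR hR1.le hexp

theorem maxPacket_rpow_mul_eLpNorm_rpow_le (h : IsDecomposition R A K f c φ) (hR : 0 < R)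
    (hf : MemLp f 2) (hf0 : eLpNorm f 2 volume ≠ 0) {ε : ℝ} (hε : 0 ≤ ε) :
    maxPacket c φ ^ (1 / 4 : ℝ) * eLpNorm f 2 volume ^ (3 / 4 : ℝ) ≤
      sizeConst A K ^ ε * sizeRatio f c φ ^ (1 / 4 - ε) * eLpNorm f 2 volume := by
  set F := eLpNorm f 2 volume
  have hS0 : sizeRatio f c φ ≠ 0 := (ENNReal.div_pos (h.maxPacket_ne_zero hf0) hf.2.ne).ne'
  have hStop : sizeRatio f c φ ≠ ∞ := ENNReal.div_ne_top (h.maxPacket_ne_top hR hf) hf0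
  have hS : sizeRatio f c φ ≤ sizeConst A K := ENNReal.div_le_of_le_mul (h.maxPacket_le hR)
  calc _ = sizeRatio f c φ ^ (1 / 4 : ℝ) * (F ^ (1 / 4 : ℝ) * F ^ (3 / 4 : ℝ)) := by
        rw [← mul_assoc, ← ENNReal.mul_rpow_of_nonneg _ _ (by norm_num), sizeRatio,
          ENNReal.div_mul_cancel hf0 hf.2.ne]
    _ = sizeRatio f c φ ^ ε * sizeRatio f c φ ^ (1 / 4 - ε) * F := by
        rw [← ENNReal.rpow_add_of_nonneg _ _ (by norm_num) (by norm_num),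
          ← ENNReal.rpow_add _ _ hS0 hStop]
        norm_num
    _ ≤ _ := by gcongr

end IsDecomposition

theorem aestronglyMeasurable_of_continuousOn_of_support_subset {f : ℝ → ℂ} {S : Set ℝ}
    (hf : ContinuousOn f S) (hS : MeasurableSet S) (hfS : Function.support f ⊆ S) :
    AEStronglyMeasurable f := by
  rw [← indicator_eq_self.2 hfS, aestronglyMeasurable_indicator_iff hS]
  exact hf.aestronglyMeasurable hS

end WavePacket

end

theorem proposition4p1_general (A : ℝ≥0) (K : ℕ → ℝ) (ε : ℝ) (hε : 0 < ε) :
    ∃ C : ℝ≥0, ∀ R : ℝ, 0 < R → (ε ≤ 1 / 8 ∨ 1 ≤ R) →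
      ∀ f : ℝ → ℂ, AEStronglyMeasurable f →
      ∀ (c : WavePacket.Index R → ℂ) (φ : WavePacket.Index R → ℝ → ℂ),
        WavePacket.IsDecomposition R A K f c φ →
        eLpNorm (fun z : ℝ × ℝ => WavePacket.extensionOp f z.1 z.2) 4
            (volume.restrict (WavePacket.disc R)) ≤
          C * ENNReal.ofReal (R ^ (1 / 8 + ε)) *
            WavePacket.sizeRatio f c φ ^ (1 / 4 - ε) * eLpNorm f 2 volume := by
  obtain ⟨C, hC⟩ := WavePacket.IsDecomposition.exists_eLpNorm_extensionOp_le A K hε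
  refine ⟨C * WavePacket.sizeConst A K ^ ε, fun R hR hRε f hf c φ h => ?_⟩
  have hf2 := h.memLp_of_aestronglyMeasurable hR hf
  refine (hC h hR hRε hf2).trans ?_
  by_cases hf0 : eLpNorm f 2 volume = 0
  · simp [hf0]
  · calc _ ≤ C * ENNReal.ofReal (R ^ (1 / 8 + ε)) * _ :=
          mul_le_mul_right (h.maxPacket_rpow_mul_eLpNorm_rpow_le hR hf2 hf0 hε.le) _
      _ = _ := by
          rw [ENNReal.coe_mul, ENNReal.coe_rpow_of_nonneg _ hε.le]
          ring

theorem proposition4p1 (A : ℝ≥0) (K : ℕ → ℝ) (ε : ℝ) (hε : 0 < ε) :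
    ∃ C : ℝ≥0, ∀ R : ℝ, 0 < R → (ε ≤ 1 / 8 ∨ 1 ≤ R) →
      ∀ f : ℝ → ℂ, ContDiffOn ℝ ((⊤ : ℕ∞) : WithTop ℕ∞) f (Icc (-1) 1) → Function.support f ⊆ Icc (-1) 1 →
      ∀ (c : WavePacket.Index R → ℂ) (φ : WavePacket.Index R → ℝ → ℂ),
        WavePacket.IsDecomposition R A K f c φ →
        eLpNorm (fun z : ℝ × ℝ => WavePacket.extensionOp f z.1 z.2) 4
            (volume.restrict (WavePacket.disc R)) ≤
          C * ENNReal.ofReal (R ^ (1 / 8 + ε)) *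
            WavePacket.sizeRatio f c φ ^ (1 / 4 - ε) * eLpNorm f 2 volume := by
  exact (proposition4p1_general A K ε hε).imp fun _ hC R hR hRε f hf hsupp => hC R hR hRε f <|
    WavePacket.aestronglyMeasurable_of_continuousOn_of_support_subset hf.continuousOn
      measurableSet_Icc hsupp
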